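/- Let $d\ge 3$ and let $\mu$ be a positive finite Borel measure on $\mathbb{R}^d$, with Riesz potential $$u(x)=(P\mu)(x)=\int_{\mathbb{R}^d}\frac{1}{|x-y|^{d-2}}\,d\mu(y)\in[0,\infty],\qquad x\in\mathbb{R}^d .$$ For compact $K\subset\mathbb{R}^d$ let $\operatorname{Cap}(K)$ be the Newtonian capacity, i.e. the supremum of $\nu(K)$ over all positive finite Borel measures $\nu$ supported on $K$ with $(P\nu)(x)\le 1$ for all $x\in\mathbb{R}^d$; for an arbitrary set $E$ let $\operatorname{Cap}(E)$ be the supremum of $\operatorname{Cap}(K)$ over compact $K\subset E$. Say that $u$ is differentiable in the capacity sense at $a\in\mathbb{R}^d$ if $u(a)<\infty$ and there are real numbers $A_1,\dots,A_d$ such that, with $$Q(x)=\frac{\bigl|u(x)-u(a)-\sum_{i=1}^d A_i(x_i-a_i)\bigr|}{|x-a|}$$ (where $Q(x)=\infty$ if $u(x)=\infty$, and $Q(a)=0$), one has $$\lim_{r\to0^+}\frac{\sup_{t>0}\,t\,\operatorname{Cap}(\{x\in B(a,r):Q(x)>t\})}{\operatorname{Cap}(B(a,r))}=0 .$$ Then,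 for every $a\in\mathbb{R}^d$, $u$ is differentiable in the capacity sense at $a$ if and only if both $$\lim_{r\to0^+}\frac{\mu(B(a,r))}{r^{d-1}}=0$$ and the principal value $$\operatorname{p.v.}\int\frac{a-y}{|a-y|^d}\,d\mu(y)=\lim_{\varepsilon\to0^+}\int_{|y-a|>\varepsilon}\frac{a-y}{|a-y|^d}\,d\mu(y)$$ exists (as a vector of $\mathbb{R}^d$). -/

import Mathlib

open Set Filter Topology MeasureTheory
open scoped ENNReal NNReal

noncomputable section

namespace CapDiff

/-- The Riesz potential `u(x) = ∫ |x - y|^{-(d-2)} dμ(y)` of a positive measure on `ℝ^d`, with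
values in `[0, ∞]`. The kernel is used for `d ≥ 3`, where it equals `∞` on the diagonal. -/
def rieszPotential {d : ℕ} (μ : Measure (EuclideanSpace ℝ (Fin d)))
    (x : EuclideanSpace ℝ (Fin d)) : ℝ≥0∞ :=
  ∫⁻ y, (‖x - y‖ₑ ^ (d - 2))⁻¹ ∂μ

/-- The Newtonian capacity of a compact set `K`: the supremum of `ν(K)` over the positive finite
Borel measures `ν` supported on `K` whose Riesz potential is at most `1` at every point. -/
def compactCap {d : ℕ} (K : Set (EuclideanSpace ℝ (Fin d))) : ℝ≥0∞ :=
  ⨆ (ν : Measure (EuclideanSpace ℝ (Fin d))) (_ : IsFiniteMeasure ν) (_ : ν Kᶜ = 0)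
    (_ : ∀ x, rieszPotential ν x ≤ 1), ν K

/-- The Newtonian capacity of a set: the supremum of the capacities of its compact subsets. -/
def newtonianCap {d : ℕ} (E : Set (EuclideanSpace ℝ (Fin d))) : ℝ≥0∞ :=
  ⨆ (K : Set (EuclideanSpace ℝ (Fin d))) (_ : IsCompact K) (_ : K ⊆ E), compactCap K

/-- The first order difference quotient
`Q(x) = |u(x) - u(a) - ∑ A_i (x_i - a_i)| / |x - a|`.
When `u a` is finite, it is `∞` at the points `x ≠ a` where `u x` is infinite; it is `0` at
`x = a`. -/
def remainderQuotient {d : ℕ} (u : EuclideanSpace ℝ (Fin d) → EReal)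
    (a : EuclideanSpace ℝ (Fin d)) (A : Fin d → ℝ) (x : EuclideanSpace ℝ (Fin d)) : ℝ≥0∞ :=
  (u x - u a - ((∑ i, A i * (x i - a i) : ℝ) : EReal)).abs / ‖x - a‖ₑ

/-- Differentiability in the capacity sense at `a`: the value `u a` is a real number, and there
are real numbers `A_1, …, A_d` such that
`sup_{t > 0} t Cap({x ∈ B(a,r) : Q(x) > t}) / Cap(B(a,r)) → 0` as `r → 0`. -/
def DifferentiableAtCap {d : ℕ} (u : EuclideanSpace ℝ (Fin d) → EReal)
    (a : EuclideanSpace ℝ (Fin d)) : Prop :=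
  u a ≠ ⊤ ∧ u a ≠ ⊥ ∧ ∃ A : Fin d → ℝ,
    Tendsto (fun r : ℝ =>
        (⨆ (t : ℝ≥0) (_ : 0 < t),
          (t : ℝ≥0∞) *
            newtonianCap {x | x ∈ Metric.ball a r ∧ (t : ℝ≥0∞) < remainderQuotient u a A x}) /
        newtonianCap (Metric.ball a r))
      (𝓝[>] 0) (𝓝 0)

end CapDiff

end

noncomputable section

namespace CapDiff

/-! ### Dyadic estimates for integrals of powers of the distance -/

section Dyadic

variable {E : Type*} [NormedAddCommGroup E]

/-! Cut the potential at a radius `s ≥ 2‖x - a‖` around `a`. The far part is smooth at `x`, and a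
Taylor expansion of the kernel makes it affine up to `‖x - a‖² * tailIntegral`, with gradient `-(d -
2) * truncatedRiesz`. Hence the remainder differs from `⟨gradientDefect, x - a⟩` by at most the near
potentials at `x` and at `a` plus that quadratic term (`abs_remainder_sub_inner_le`). This one
inequality is used in both directions.

Sufficiency. If `μ(B(a,r)) = o(r^(d-1))`, dyadic summation makes the near potential at `a` an `o(s)`
and the tail integral an `o(1/s)`. With `s = 2‖x - a‖` the quotient is then at most `nearPotential x
/ ‖x - a‖ + o(1)`. Integrate this against an admissible measure `σ` and apply Tonelli: on the near
region `‖x - a‖⁻¹ ≤ 2‖y - a‖⁻¹`, and the potential of `σ` is at most 1, which leaves `2 ∫_{B(a,2r)}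
‖a - y‖⁻¹ dμ = o(r^(d-2))` (`lintegral_nearPotential_div_le`). Chebyshev's inequality bounds the
capacity of the superlevel sets.

Necessity. By the isocapacitary inequality, the weak type bound for capacity becomes a weak `L^p`
bound for Lebesgue measure with `p = d/(d-2) > 1`, so the remainder has integral `o(r^(d+1))` over
`B(a,r)`. Testing the potential against `-Δφ` for a bump `φ` annihilates affine functions and
dominates the mass of `μ` near the centre; after scaling, `μ(B(a,r)) ≤ C r⁻² ∫_{B(a,3r)} |remainder|
= o(r^(d-1))` (`exists_measure_ball_le`). With this growth known, the splitting inequality, averaged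
over a ball where the linear form of the gradient defect is large, forces the defect to 0, so the
truncated Riesz transforms converge. -/

theorem inv_enorm_pow_le {z : E} {s : ℝ} (hs : 0 < s) (h : s ≤ ‖z‖) (p : ℕ) :
    (‖z‖ₑ ^ p)⁻¹ ≤ ENNReal.ofReal ((s ^ p)⁻¹) := by
  rw [ENNReal.ofReal_inv_of_pos (by positivity), ENNReal.ofReal_pow hs.le]
  gcongr
  rw [← ofReal_norm]
  exact ENNReal.ofReal_le_ofReal h

theorem le_inv_enorm_pow {z : E} {s : ℝ} (hs : 0 < s) (h : ‖z‖ ≤ s) (p : ℕ) :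
    ENNReal.ofReal ((s ^ p)⁻¹) ≤ (‖z‖ₑ ^ p)⁻¹ := by
  rw [ENNReal.ofReal_inv_of_pos (by positivity), ENNReal.ofReal_pow hs.le]
  gcongr
  rw [← ofReal_norm]
  exact ENNReal.ofReal_le_ofReal h

theorem tsum_ofReal_half_pow (c : ℝ) (hc : 0 ≤ c) :
    ∑' j : ℕ, ENNReal.ofReal (c * (1 / 2) ^ j) = ENNReal.ofReal (2 * c) := by
  rw [← ENNReal.ofReal_tsum_of_nonneg (fun j => by positivity)
    (summable_geometric_two.mul_left c), tsum_mul_left, tsum_geometric_two, mul_comm]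

variable [MeasurableSpace E] [BorelSpace E]

/-- Polynomial growth of a measure at a point controls the integral of a negative power of the
distance over a ball. -/
theorem lintegral_ball_inv_enorm_pow_le (μ : Measure E) (a : E) (p m : ℕ) (hm : 1 ≤ m)
    {M R : ℝ} (hM : 0 ≤ M) (hR : 0 < R)
    (h : ∀ s, 0 < s → s ≤ R → μ (Metric.ball a s) ≤ ENNReal.ofReal (M * s ^ (p + m))) :
    ∫⁻ y in Metric.ball a R, (‖a - y‖ₑ ^ p)⁻¹ ∂μ ≤ ENNReal.ofReal (2 ^ (p + 1) * M * R ^ m) := by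
  -- The dyadic shells below miss the centre. An atom there is excluded because the growth exponent
  -- `p + m` is positive.
  have h0 : μ {a} = 0 := by
    refine le_antisymm (ge_of_tendsto (x := 𝓝[>] (0 : ℝ))
      (f := fun s => ENNReal.ofReal (M * s ^ (p + m))) ?_ ?_) bot_le
    · have : Tendsto (fun s : ℝ => ENNReal.ofReal (M * s ^ (p + m))) (𝓝 0) (𝓝 0) := by
        have : Continuous (fun s : ℝ => ENNReal.ofReal (M * s ^ (p + m))) :=
          ENNReal.continuous_ofReal.comp (by fun_prop)
        convert! this.tendsto 0 using 2
        rw [zero_pow (by omega)]; simp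
      exact this.mono_left nhdsWithin_le_nhds
    · filter_upwards [Ioc_mem_nhdsGT hR] with s hs
      exact (measure_mono (by simpa using hs.1)).trans (h s hs.1 hs.2)
  set A : ℕ → Set E := fun j =>
    {y | R * (1 / 2) ^ (j + 1) ≤ ‖a - y‖ ∧ ‖a - y‖ < R * (1 / 2) ^ j} with hA
  have hsub : Metric.ball a R ⊆ {a} ∪ ⋃ j, A j := by
    intro y hy
    by_cases hya : y = a
    · left; exact hya
    right
    have hpos : 0 < ‖a - y‖ := norm_pos_iff.2 (sub_ne_zero.2 (Ne.symm hya))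
    have hlt : ‖a - y‖ < R := by rwa [Metric.mem_ball, dist_comm, dist_eq_norm] at hy
    obtain ⟨j, hj1, hj2⟩ := exists_nat_pow_near_of_lt_one (x := ‖a - y‖ / R)
      (y := (1 / 2 : ℝ)) (by positivity) ((div_le_one hR).2 hlt.le) (by norm_num) (by norm_num)
    rw [lt_div_iff₀ hR] at hj1
    rw [div_le_iff₀ hR] at hj2
    -- The power bracketing is closed on the outer side, whereas the shells are open there: a point
    -- on the outer sphere of shell `j` belongs to shell `j - 1`, and `j = 0` is excluded because
    -- the ball is open.
    rcases hj2.lt_or_eq with hj2 | hj2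
    · exact mem_iUnion.2 ⟨j, by rw [mul_comm]; exact hj1.le, by rw [mul_comm]; exact hj2⟩
    · have hj0 : j ≠ 0 := by
        rintro rfl
        simp at hj2
        linarith
      obtain ⟨i, rfl⟩ := Nat.exists_eq_succ_of_ne_zero hj0
      refine mem_iUnion.2 ⟨i, by rw [mul_comm]; exact hj2.ge, ?_⟩
      rw [hj2, Nat.succ_eq_add_one, pow_succ, mul_comm]
      have : 0 < R * (1 / 2) ^ i := by positivity
      nlinarith
  have hAm : ∀ j, MeasurableSet (A j) := fun j =>
    (measurableSet_le (f := fun _ : E => _) (g := fun y : E => ‖a - y‖) (by fun_prop)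
      (by fun_prop)).inter
      (measurableSet_lt (f := fun y : E => ‖a - y‖) (g := fun _ : E => _) (by fun_prop)
      (by fun_prop))
  calc ∫⁻ y in Metric.ball a R, (‖a - y‖ₑ ^ p)⁻¹ ∂μ
      ≤ ∫⁻ y in {a} ∪ ⋃ j, A j, (‖a - y‖ₑ ^ p)⁻¹ ∂μ := lintegral_mono_set hsub
    _ ≤ ∫⁻ y in {a}, (‖a - y‖ₑ ^ p)⁻¹ ∂μ + ∫⁻ y in ⋃ j, A j, (‖a - y‖ₑ ^ p)⁻¹ ∂μ :=
        lintegral_union_le _ _ _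
    _ = ∫⁻ y in ⋃ j, A j, (‖a - y‖ₑ ^ p)⁻¹ ∂μ := by
        rw [setLIntegral_measure_zero _ _ h0, zero_add]
    _ ≤ ∑' j, ∫⁻ y in A j, (‖a - y‖ₑ ^ p)⁻¹ ∂μ := lintegral_iUnion_le _ _
    _ ≤ ∑' j : ℕ, ENNReal.ofReal (2 ^ p * M * R ^ m * (1 / 2) ^ j) := by
        refine ENNReal.tsum_le_tsum fun j => ?_
        have hs : 0 < R * (1 / 2) ^ j := by positivity
        have hs' : 0 < R * (1 / 2) ^ (j + 1) := by positivity
        calc ∫⁻ y in A j, (‖a - y‖ₑ ^ p)⁻¹ ∂μ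
            ≤ ∫⁻ y in A j, ENNReal.ofReal (((R * (1 / 2) ^ (j + 1)) ^ p)⁻¹) ∂μ :=
              setLIntegral_mono' (hAm j) fun y hy => inv_enorm_pow_le hs' hy.1 p
          _ = ENNReal.ofReal (((R * (1 / 2) ^ (j + 1)) ^ p)⁻¹) * μ (A j) := setLIntegral_const _ _
          _ ≤ ENNReal.ofReal (((R * (1 / 2) ^ (j + 1)) ^ p)⁻¹) *
              ENNReal.ofReal (M * (R * (1 / 2) ^ j) ^ (p + m)) := by
              gcongr
              refine (measure_mono fun y hy => ?_).trans (h _ hs ?_)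
              · rw [Metric.mem_ball, dist_comm, dist_eq_norm]; exact hy.2
              · exact mul_le_of_le_one_right hR.le (pow_le_one₀ (by norm_num) (by norm_num))
          _ ≤ ENNReal.ofReal (2 ^ p * M * R ^ m * (1 / 2) ^ j) := by
              rw [← ENNReal.ofReal_mul (by positivity)]
              refine ENNReal.ofReal_le_ofReal ?_
              have e : ((R * (1 / 2) ^ (j + 1)) ^ p)⁻¹ * (M * (R * (1 / 2) ^ j) ^ (p + m)) =
                  2 ^ p * M * R ^ m * ((1 / 2) ^ j) ^ m := by
                have : R * (1 / 2) ^ (j + 1) = (R * (1 / 2) ^ j) / 2 := by ring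
                rw [this, div_pow, pow_add, mul_pow _ _ m]
                field_simp
              rw [e]
              gcongr
              -- Since `m ≥ 1`, the shell contributions decay at least like `2^(-j)`.
              exact pow_le_of_le_one (by positivity)
                (pow_le_one₀ (by norm_num) (by norm_num)) (by omega)
    _ = ENNReal.ofReal (2 ^ (p + 1) * M * R ^ m) := by
        rw [tsum_ofReal_half_pow _ (by positivity)]
        congr 1; ring

/-- Polynomial growth of a measure at a point controls the integral of a negative power of the
distance over the complement of a ball. -/
theorem lintegral_compl_ball_inv_enorm_pow_le (μ : Measure E) (a : E) (q : ℕ)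
    {M R : ℝ} (hM : 0 ≤ M) (hR : 0 < R)
    (h : ∀ s, 0 < s → μ (Metric.ball a s) ≤ ENNReal.ofReal (M * s ^ q)) :
    ∫⁻ y in {y | R ≤ ‖a - y‖}, (‖a - y‖ₑ ^ (q + 1))⁻¹ ∂μ ≤
      ENNReal.ofReal (2 ^ (q + 1) * M / R) := by
  set A : ℕ → Set E := fun j =>
    {y | R * 2 ^ j ≤ ‖a - y‖ ∧ ‖a - y‖ < R * 2 ^ (j + 1)} with hA
  have hsub : {y | R ≤ ‖a - y‖} ⊆ ⋃ j, A j := by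
    intro y hy
    obtain ⟨j, hj1, hj2⟩ := exists_nat_pow_near (x := ‖a - y‖ / R)
      (y := (2 : ℝ)) ((one_le_div hR).2 hy) (by norm_num)
    rw [le_div_iff₀ hR] at hj1
    rw [div_lt_iff₀ hR] at hj2
    exact mem_iUnion.2 ⟨j, by rw [mul_comm]; exact hj1, by rw [mul_comm]; exact hj2⟩
  have hAm : ∀ j, MeasurableSet (A j) := fun j =>
    (measurableSet_le (f := fun _ : E => _) (g := fun y : E => ‖a - y‖) (by fun_prop)
      (by fun_prop)).inter
      (measurableSet_lt (f := fun y : E => ‖a - y‖) (g := fun _ : E => _) (by fun_prop)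
      (by fun_prop))
  calc ∫⁻ y in {y | R ≤ ‖a - y‖}, (‖a - y‖ₑ ^ (q + 1))⁻¹ ∂μ
      ≤ ∫⁻ y in ⋃ j, A j, (‖a - y‖ₑ ^ (q + 1))⁻¹ ∂μ := lintegral_mono_set hsub
    _ ≤ ∑' j, ∫⁻ y in A j, (‖a - y‖ₑ ^ (q + 1))⁻¹ ∂μ := lintegral_iUnion_le _ _
    _ ≤ ∑' j : ℕ, ENNReal.ofReal (2 ^ q * M / R * (1 / 2) ^ j) := by
        refine ENNReal.tsum_le_tsum fun j => ?_
        have hs : 0 < R * 2 ^ j := by positivity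
        calc ∫⁻ y in A j, (‖a - y‖ₑ ^ (q + 1))⁻¹ ∂μ
            ≤ ∫⁻ y in A j, ENNReal.ofReal (((R * 2 ^ j) ^ (q + 1))⁻¹) ∂μ :=
              setLIntegral_mono' (hAm j) fun y hy => inv_enorm_pow_le hs hy.1 _
          _ = ENNReal.ofReal (((R * 2 ^ j) ^ (q + 1))⁻¹) * μ (A j) := setLIntegral_const _ _
          _ ≤ ENNReal.ofReal (((R * 2 ^ j) ^ (q + 1))⁻¹) *
              ENNReal.ofReal (M * (R * 2 ^ (j + 1)) ^ q) := by
              gcongr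
              refine (measure_mono fun y hy => ?_).trans (h _ (by positivity))
              rw [Metric.mem_ball, dist_comm, dist_eq_norm]; exact hy.2
          _ = ENNReal.ofReal (2 ^ q * M / R * (1 / 2) ^ j) := by
              rw [← ENNReal.ofReal_mul (by positivity)]
              congr 1
              have : R * 2 ^ (j + 1) = (R * 2 ^ j) * 2 := by ring
              rw [this, mul_pow _ 2 q, pow_succ _ q, one_div, inv_pow]
              field_simp
    _ = ENNReal.ofReal (2 ^ (q + 1) * M / R) := by
        rw [tsum_ofReal_half_pow _ (by positivity)]
        congr 1; ring

end Dyadic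

/-! ### Newtonian capacity and its comparison with volume -/

variable {d : ℕ}

local notation "𝔼" => EuclideanSpace ℝ (Fin d)

theorem volume_ball_eq (hd : 3 ≤ d) (x : 𝔼) {r : ℝ} (hr : 0 ≤ r) :
    volume (Metric.ball x r) =
      ENNReal.ofReal (volume.real (Metric.ball (0 : 𝔼) 1) * r ^ d) := by
  have : Nonempty (Fin d) := ⟨⟨0, by omega⟩⟩
  have : Nontrivial 𝔼 := inferInstance
  rw [Measure.addHaar_ball volume x hr, finrank_euclideanSpace_fin,
    ENNReal.ofReal_mul measureReal_nonneg, mul_comm, ofReal_measureReal]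

theorem volume_unit_ball_pos : 0 < volume.real (Metric.ball (0 : 𝔼) 1) :=
  ENNReal.toReal_pos (Metric.measure_ball_pos _ _ one_pos).ne' measure_ball_lt_top.ne

/-- Puts the volume in the form `R ^ d` expected by the kernel estimates; `R = (v + 1) * r` avoids a
`d`-th root, as `v ≤ (v + 1) ^ d`. -/
theorem volume_ball_le_pow (hd : 3 ≤ d) (x : 𝔼) {r : ℝ} (hr : 0 < r) :
    volume (Metric.ball x r) ≤
      ENNReal.ofReal (((volume.real (Metric.ball (0 : 𝔼) 1) + 1) * r) ^ d) := by
  have hv : 0 < volume.real (Metric.ball (0 : 𝔼) 1) := volume_unit_ball_pos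
  rw [volume_ball_eq hd x hr.le, mul_pow]
  refine ENNReal.ofReal_le_ofReal (mul_le_mul_of_nonneg_right ?_ (by positivity))
  exact (le_add_of_nonneg_right zero_le_one).trans (le_self_pow₀ (by linarith) (by omega))

/-- Up to a constant, a ball centred at `x` is the worst set of given volume. Inside `B(x,R)` the
dyadic bound gives `R²`; outside, the kernel is at most `R^(2-d)` on a set of volume at most `R^d`.
-/
theorem exists_lintegral_kernel_le (hd : 3 ≤ d) :
    ∃ C : ℝ, 0 < C ∧ ∀ (S : Set 𝔼) (R : ℝ), 0 < R → volume S ≤ ENNReal.ofReal (R ^ d) →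
      ∀ x : 𝔼, ∫⁻ y in S, (‖x - y‖ₑ ^ (d - 2))⁻¹ ≤ ENNReal.ofReal (C * R ^ 2) := by
  set v := volume.real (Metric.ball (0 : 𝔼) 1) with hv
  have hvp : 0 < v := volume_unit_ball_pos
  refine ⟨2 ^ (d - 2 + 1) * v + 1, by positivity, fun S R hR hS x => ?_⟩
  have hd2 : d = d - 2 + 2 := by omega
  have h1 : ∫⁻ y in Metric.ball x R, (‖x - y‖ₑ ^ (d - 2))⁻¹ ≤
      ENNReal.ofReal (2 ^ (d - 2 + 1) * v * R ^ 2) := by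
    refine lintegral_ball_inv_enorm_pow_le volume x (d - 2) 2 (by norm_num) hvp.le hR ?_
    intro s hs _
    rw [volume_ball_eq hd x hs.le, ← hd2]
  have h2 : ∫⁻ y in S \ Metric.ball x R, (‖x - y‖ₑ ^ (d - 2))⁻¹ ≤ ENNReal.ofReal (R ^ 2) := by
    have hb : ∀ᵐ y ∂(volume.restrict (S \ Metric.ball x R)),
        (‖x - y‖ₑ ^ (d - 2))⁻¹ ≤ ENNReal.ofReal ((R ^ (d - 2))⁻¹) := by
      have : ∀ᵐ y ∂((volume.restrict S).restrict (Metric.ball x R)ᶜ),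
        (‖x - y‖ₑ ^ (d - 2))⁻¹ ≤ ENNReal.ofReal ((R ^ (d - 2))⁻¹) := by
        refine ae_restrict_of_forall_mem measurableSet_ball.compl fun y hy => ?_
        refine inv_enorm_pow_le hR ?_ _
        rw [mem_compl_iff, Metric.mem_ball, dist_comm, dist_eq_norm, not_lt] at hy
        exact hy
      rwa [Measure.restrict_restrict measurableSet_ball.compl, inter_comm] at this
    refine (lintegral_mono_ae hb).trans ?_
    rw [setLIntegral_const]
    calc ENNReal.ofReal ((R ^ (d - 2))⁻¹) * volume (S \ Metric.ball x R)
        ≤ ENNReal.ofReal ((R ^ (d - 2))⁻¹) * ENNReal.ofReal (R ^ d) := by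
          gcongr; exact (measure_mono sdiff_subset).trans hS
      _ = ENNReal.ofReal (R ^ 2) := by
          rw [← ENNReal.ofReal_mul (by positivity)]
          congr 1
          conv_lhs => rw [hd2]
          rw [pow_add]; simp only [Nat.add_sub_cancel]; field_simp
  calc ∫⁻ y in S, (‖x - y‖ₑ ^ (d - 2))⁻¹
      ≤ ∫⁻ y in Metric.ball x R ∪ (S \ Metric.ball x R), (‖x - y‖ₑ ^ (d - 2))⁻¹ :=
        lintegral_mono_set (by rw [union_sdiff_self]; exact subset_union_right)
    _ ≤ _ := lintegral_union_le _ _ _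
    _ ≤ _ := add_le_add h1 h2
    _ = _ := by
        rw [← ENNReal.ofReal_add (by positivity) (by positivity)]
        congr 1; ring

theorem measurable_rieszPotential (μ : Measure 𝔼) [SFinite μ] :
    Measurable (rieszPotential μ) := by
  unfold rieszPotential
  exact Measurable.lintegral_prod_right' (f := fun p : 𝔼 × 𝔼 => (‖p.1 - p.2‖ₑ ^ (d - 2))⁻¹)
    (by fun_prop)

theorem le_newtonianCap {K E : Set 𝔼} (hK : IsCompact K) (hKE : K ⊆ E) :
    compactCap K ≤ newtonianCap E :=
  le_iSup₂_of_le K hK (le_iSup_of_le hKE le_rfl)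

theorem newtonianCap_mono {E F : Set 𝔼} (h : E ⊆ F) : newtonianCap E ≤ newtonianCap F :=
  iSup₂_le fun _ hK => iSup_le fun hKE => le_newtonianCap hK (hKE.trans h)

theorem le_compactCap {K : Set 𝔼} (ν : Measure 𝔼) [hf : IsFiniteMeasure ν] (h0 : ν Kᶜ = 0)
    (h1 : ∀ x, rieszPotential ν x ≤ 1) : ν K ≤ compactCap K :=
  le_iSup₂_of_le ν hf (le_iSup₂_of_le h0 h1 le_rfl)

/-- To bound the capacity of a set it suffices to bound the masses of the admissible measures
carried by its compact subsets. -/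
theorem newtonianCap_le {E : Set 𝔼} {B : ℝ≥0∞}
    (h : ∀ K, IsCompact K → K ⊆ E → ∀ ν : Measure 𝔼, IsFiniteMeasure ν → ν Kᶜ = 0 →
      (∀ x, rieszPotential ν x ≤ 1) → ν K ≤ B) : newtonianCap E ≤ B :=
  iSup₂_le fun K hK => iSup_le fun hKE => iSup₂_le fun ν hν => iSup₂_le fun h0 h1 =>
    h K hK hKE ν hν h0 h1

/-- Test admissibility at the centre `a`, where the kernel is at least `r^(2-d)` on all of `K`. -/
theorem measure_le_of_rieszPotential_le_one {a : 𝔼} {r : ℝ} (hr : 0 < r) {K : Set 𝔼}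
    (hK : IsCompact K) (hKr : K ⊆ Metric.ball a r)
    {ν : Measure 𝔼} (h1 : ∀ x, rieszPotential ν x ≤ 1) : ν K ≤ ENNReal.ofReal (r ^ (d - 2)) := by
  have : ENNReal.ofReal ((r ^ (d - 2))⁻¹) * ν K ≤ 1 := by
    refine le_trans ?_ (h1 a)
    rw [← setLIntegral_const]
    refine le_trans (setLIntegral_mono' hK.measurableSet fun y hy => ?_)
      (setLIntegral_le_lintegral K _)
    refine le_inv_enorm_pow hr ?_ _
    have := hKr hy
    rw [Metric.mem_ball, dist_comm, dist_eq_norm] at this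
    exact this.le
  rw [ENNReal.ofReal_inv_of_pos (by positivity)] at this
  rwa [mul_comm, ← div_eq_mul_inv, ENNReal.div_le_iff (by positivity) (by simp), one_mul] at this

theorem newtonianCap_ball_le (a : 𝔼) {r : ℝ} (hr : 0 < r) :
    newtonianCap (Metric.ball a r) ≤ ENNReal.ofReal (r ^ (d - 2)) :=
  newtonianCap_le fun _ hK hKE _ _ _ h1 => measure_le_of_rieszPotential_le_one hr hK hKE h1

/-- Isocapacitary inequality. -/
theorem exists_volume_le_newtonianCap (hd : 3 ≤ d) :
    ∃ C : ℝ, 0 < C ∧ (∀ (S : Set 𝔼) (R : ℝ), 0 < R → volume S ≤ ENNReal.ofReal (R ^ d) →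
      ∀ x : 𝔼, ∫⁻ y in S, (‖x - y‖ₑ ^ (d - 2))⁻¹ ≤ ENNReal.ofReal (C * R ^ 2)) ∧
      ∀ (S : Set 𝔼) (R : ℝ), 0 < R → MeasurableSet S →
      volume S ≤ ENNReal.ofReal (R ^ d) →
      volume S ≤ ENNReal.ofReal (C * R ^ 2) * newtonianCap S := by
  obtain ⟨C, hC, h⟩ := exists_lintegral_kernel_le hd
  refine ⟨C, hC, h, fun S R hR hSm hS => ?_⟩
  rw [hSm.measure_eq_iSup_isCompact]
  refine iSup₂_le fun K hKS => iSup_le fun hK => ?_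
  have hc0 : ENNReal.ofReal (C * R ^ 2) ≠ 0 := by simp; positivity
  have hct : ENNReal.ofReal (C * R ^ 2) ≠ ∞ := by simp
  set c := ENNReal.ofReal (C * R ^ 2) with hc
  have hfin : volume K < ∞ := hK.measure_lt_top
  -- Lebesgue measure on `K`, divided by the uniform bound for its potential, is admissible.
  set ν : Measure 𝔼 := c⁻¹ • volume.restrict K with hν
  have : IsFiniteMeasure ν := by
    constructor
    rw [hν, Measure.smul_apply, Measure.restrict_apply_univ, smul_eq_mul]
    exact ENNReal.mul_lt_top (by simp [hc0, pos_iff_ne_zero]) hfin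
  have hνK : ν K = c⁻¹ * volume K := by
    rw [hν, Measure.smul_apply, Measure.restrict_apply_self, smul_eq_mul]
  have key : ν K ≤ newtonianCap S := by
    refine le_trans (le_compactCap ν ?_ ?_) (le_newtonianCap hK hKS)
    · rw [hν, Measure.smul_apply, Measure.restrict_apply hK.measurableSet.compl]
      simp
    · intro x
      rw [rieszPotential, hν, lintegral_smul_measure, smul_eq_mul]
      calc c⁻¹ * ∫⁻ y in K, (‖x - y‖ₑ ^ (d - 2))⁻¹ ≤ c⁻¹ * c := by
            gcongr; exact h K R hR ((measure_mono hKS).trans hS) x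
        _ = 1 := ENNReal.inv_mul_cancel hc0 hct
  calc volume K = c * ν K := by rw [hνK, ← mul_assoc, ENNReal.mul_inv_cancel hc0 hct, one_mul]
    _ ≤ c * newtonianCap S := by gcongr

theorem exists_le_newtonianCap_ball (hd : 3 ≤ d) :
    ∃ c : ℝ, 0 < c ∧ ∀ (a : 𝔼) (r : ℝ), 0 < r →
      ENNReal.ofReal (c * r ^ (d - 2)) ≤ newtonianCap (Metric.ball a r) := by
  obtain ⟨C, hC, -, h⟩ := exists_volume_le_newtonianCap hd
  set v := volume.real (Metric.ball (0 : 𝔼) 1) with hv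
  have hvp : 0 < v := volume_unit_ball_pos
  refine ⟨v / (C * (v + 1) ^ 2), by positivity, fun a r hr => ?_⟩
  have h1 := h (Metric.ball a r) ((v + 1) * r) (by positivity) measurableSet_ball
    (volume_ball_le_pow hd a hr)
  rw [volume_ball_eq hd a hr.le] at h1
  rw [mul_comm (ENNReal.ofReal _), ← ENNReal.div_le_iff (by simp; positivity) (by simp),
    ← ENNReal.ofReal_div_of_pos (by positivity)] at h1
  refine le_trans (ENNReal.ofReal_le_ofReal (le_of_eq ?_)) h1
  have hd2 : r ^ d = r ^ (d - 2) * r ^ 2 := by rw [← pow_add]; congr 1; omega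
  rw [hd2, ← hv]
  field_simp

/-! ### Taylor expansion of the kernel -/

theorem abs_pow_sub_one_sub_le {t : ℝ} (h0 : 0 ≤ t) (h2 : t ≤ 2) (n : ℕ) :
    |t ^ n - 1 - n * (t - 1)| ≤ n * 2 ^ n * (t - 1) ^ 2 := by
  induction n with
  | zero => simp
  | succ n ih =>
    have e : t ^ (n + 1) - 1 - ((n + 1 : ℕ) : ℝ) * (t - 1) =
        t * (t ^ n - 1 - n * (t - 1)) + n * (t - 1) ^ 2 := by
      push_cast; ring
    have hn : (n : ℝ) ≤ 2 ^ n := by exact_mod_cast Nat.lt_two_pow_self.le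
    rw [e]
    calc |t * (t ^ n - 1 - n * (t - 1)) + n * (t - 1) ^ 2|
        ≤ |t * (t ^ n - 1 - n * (t - 1))| + |n * (t - 1) ^ 2| := abs_add_le _ _
      _ ≤ 2 * (n * 2 ^ n * (t - 1) ^ 2) + 2 ^ n * (t - 1) ^ 2 := by
          rw [abs_mul, abs_of_nonneg h0, abs_of_nonneg (by positivity : 0 ≤ n * (t - 1) ^ 2)]
          gcongr
      _ ≤ ((n + 1 : ℕ) : ℝ) * 2 ^ (n + 1) * (t - 1) ^ 2 := by
          push_cast
          have : 0 ≤ 2 ^ n * (t - 1) ^ 2 := by positivity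
          rw [pow_succ (2 : ℝ)]
          nlinarith

/-- First order Taylor expansion of `‖z‖⁻ⁿ` with a quadratic remainder. -/
theorem abs_inv_norm_pow_taylor_le {F : Type*} [NormedAddCommGroup F] [InnerProductSpace ℝ F]
    (n : ℕ) {z h : F} (hz : z ≠ 0) (hh : 2 * ‖h‖ ≤ ‖z‖) :
    |(‖z + h‖ ^ n)⁻¹ - (‖z‖ ^ n)⁻¹ + n * ((‖z‖ ^ (n + 2))⁻¹ * inner ℝ z h)| ≤
      (4 * (n * 2 ^ n) + 6 * n) * ‖h‖ ^ 2 * (‖z‖ ^ (n + 2))⁻¹ := by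
  have hsq : ‖z + h‖ ^ 2 = ‖z‖ ^ 2 + 2 * inner ℝ z h + ‖h‖ ^ 2 := norm_add_sq_real z h
  have hp : |inner ℝ z h| ≤ ‖z‖ * ‖h‖ := abs_real_inner_le_norm z h
  have hab : |‖z + h‖ - ‖z‖| ≤ ‖h‖ := by
    have := abs_norm_sub_norm_le (z + h) z
    simpa using this
  have ha : 0 < ‖z‖ := norm_pos_iff.2 hz
  generalize ‖z + h‖ = b at *
  generalize ‖z‖ = a at *
  have hδ : 0 ≤ ‖h‖ := norm_nonneg h
  generalize ‖h‖ = δ at *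
  generalize inner ℝ z h = p at *
  obtain ⟨hab1, hab2⟩ := abs_le.1 hab
  have hb1 : a / 2 ≤ b := by linarith
  have hb2 : b ≤ 3 / 2 * a := by linarith
  have hb : 0 < b := by linarith
  -- Here `a = ‖z‖` and `b = ‖z + h‖`. Working with `t = a / b` turns the inverse power of `b` into
  -- a polynomial in `t`, and `2‖h‖ ≤ ‖z‖` ensures `t ≤ 2`.
  set t := a / b with ht
  have ht0 : 0 ≤ t := by positivity
  have ht2 : t ≤ 2 := by rw [ht, div_le_iff₀ hb]; linarith
  have h1 := abs_pow_sub_one_sub_le ht0 ht2 n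
  have hta : |t - 1| ≤ 2 * δ / a := by
    have : t - 1 = (a - b) / b := by rw [ht]; field_simp
    rw [this, abs_div, abs_of_pos hb, abs_sub_comm, div_le_div_iff₀ hb ha]
    nlinarith
  have hta2 : (t - 1) ^ 2 ≤ 4 * (δ ^ 2 / a ^ 2) := by
    rw [← sq_abs]
    calc |t - 1| ^ 2 ≤ (2 * δ / a) ^ 2 := by gcongr
      _ = _ := by ring
  -- To first order `t - 1` is `-p / a²`; the error becomes quadratic on inserting `b² = a² + 2p +
  -- δ²`.
  have h2 : |t - 1 + p / a ^ 2| ≤ 6 * (δ ^ 2 / a ^ 2) := by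
    have e : t - 1 + p / a ^ 2 =
        (p * ((b - a) * (b + 2 * a)) - a ^ 2 * δ ^ 2) / (a ^ 2 * (b * (a + b))) := by
      rw [ht]
      field_simp
      linear_combination (- a ^ 2) * hsq
    have hnum : |p * ((b - a) * (b + 2 * a)) - a ^ 2 * δ ^ 2| ≤ 9 / 2 * (a ^ 2 * δ ^ 2) := by
      calc |p * ((b - a) * (b + 2 * a)) - a ^ 2 * δ ^ 2|
          ≤ |p * ((b - a) * (b + 2 * a))| + |a ^ 2 * δ ^ 2| := abs_sub _ _
        _ ≤ (a * δ) * (δ * (7 / 2 * a)) + a ^ 2 * δ ^ 2 := by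
            rw [abs_mul, abs_mul, abs_of_pos (by linarith : 0 < b + 2 * a),
              abs_of_nonneg (by positivity : 0 ≤ a ^ 2 * δ ^ 2)]
            gcongr
            linarith
        _ = _ := by ring
    rw [e, abs_div, abs_of_pos (by positivity : 0 < a ^ 2 * (b * (a + b))),
      div_le_iff₀ (by positivity)]
    refine hnum.trans ?_
    have : 6 * (δ ^ 2 / a ^ 2) * (a ^ 2 * (b * (a + b))) = 6 * δ ^ 2 * (b * (a + b)) := by
      field_simp
    rw [this]
    have : a / 2 * (a + a / 2) ≤ b * (a + b) := by gcongr
    nlinarith [sq_nonneg δ]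
  have e : (b ^ n)⁻¹ - (a ^ n)⁻¹ + n * ((a ^ (n + 2))⁻¹ * p) =
      (a ^ n)⁻¹ * ((t ^ n - 1 - n * (t - 1)) + n * (t - 1 + p / a ^ 2)) := by
    rw [ht, div_pow, pow_add]
    field_simp
    ring
  rw [e, abs_mul, abs_of_pos (by positivity : 0 < (a ^ n)⁻¹)]
  calc (a ^ n)⁻¹ * |(t ^ n - 1 - n * (t - 1)) + n * (t - 1 + p / a ^ 2)|
      ≤ (a ^ n)⁻¹ * (n * 2 ^ n * (4 * (δ ^ 2 / a ^ 2)) + n * (6 * (δ ^ 2 / a ^ 2))) := by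
        gcongr
        refine (abs_add_le _ _).trans (add_le_add (h1.trans (by gcongr)) ?_)
        rw [abs_mul, Nat.abs_cast]
        gcongr
    _ = _ := by
        rw [pow_add]
        field_simp

/-! ### Splitting the potential into near and far parts -/

section

/-- The part of the potential at `x` generated by the mass at distance at most `s` from `a`. -/
def nearPotential (μ : Measure 𝔼) (a : 𝔼) (s : ℝ) (x : 𝔼) : ℝ≥0∞ :=
  ∫⁻ y in {y | s < ‖y - a‖}ᶜ, (‖x - y‖ₑ ^ (d - 2))⁻¹ ∂μ

/-- The part of the potential at `x` generated by the mass at distance more than `s` from `a`. -/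
def farPotential (μ : Measure 𝔼) (a : 𝔼) (s : ℝ) (x : 𝔼) : ℝ :=
  ∫ y in {y | s < ‖y - a‖}, (‖x - y‖ ^ (d - 2))⁻¹ ∂μ

/-- The truncated vector valued Riesz transform. -/
def truncatedRiesz (μ : Measure 𝔼) (a : 𝔼) (s : ℝ) : 𝔼 :=
  ∫ y in {y | s < ‖y - a‖}, (‖a - y‖ ^ d)⁻¹ • (a - y) ∂μ

/-- The tail integral controlling the second order Taylor remainder. -/
def tailIntegral (μ : Measure 𝔼) (a : 𝔼) (s : ℝ) : ℝ :=
  ∫ y in {y | s < ‖y - a‖}, (‖a - y‖ ^ d)⁻¹ ∂μ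

theorem measurableSet_far (a : 𝔼) (s : ℝ) : MeasurableSet {y : 𝔼 | s < ‖y - a‖} :=
  measurableSet_lt (by fun_prop) (by fun_prop)

theorem integrableOn_inv_norm_pow (μ : Measure 𝔼) [IsFiniteMeasure μ] {S : Set 𝔼}
    (hS : MeasurableSet S) {x : 𝔼} {c : ℝ} (hc : 0 < c) (h : ∀ y ∈ S, c ≤ ‖x - y‖) (n : ℕ) :
    IntegrableOn (fun y => (‖x - y‖ ^ n)⁻¹) S μ := by
  refine Measure.integrableOn_of_bounded (M := (c ^ n)⁻¹) (measure_ne_top _ _) ?_ ?_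
  · exact (by fun_prop : Measurable fun y => (‖x - y‖ ^ n)⁻¹).aestronglyMeasurable
  · refine ae_restrict_of_forall_mem hS fun y hy => ?_
    rw [Real.norm_of_nonneg (by positivity)]
    gcongr
    exact h y hy

theorem half_le_norm_sub_of_far {a x y : 𝔼} {s : ℝ} (hx : 2 * ‖x - a‖ ≤ s) (hy : s < ‖y - a‖) :
    s / 2 ≤ ‖x - y‖ := by
  have : ‖y - a‖ ≤ ‖x - y‖ + ‖x - a‖ := by
    calc ‖y - a‖ = ‖(x - a) - (x - y)‖ := by congr 1; abel
      _ ≤ ‖x - a‖ + ‖x - y‖ := norm_sub_le _ _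
      _ = _ := add_comm _ _
  linarith

/-- The condition `2‖x - a‖ ≤ s` keeps far points at distance at least `s / 2` from `x`, so the far
part is a finite real number and any infinity sits in the near part. -/
theorem rieszPotential_eq_near_add_far (μ : Measure 𝔼) [IsFiniteMeasure μ] {a x : 𝔼} {s : ℝ}
    (hs : 0 < s) (hx : 2 * ‖x - a‖ ≤ s) :
    rieszPotential μ x = nearPotential μ a s x + ENNReal.ofReal (farPotential μ a s x) := by
  have hint := integrableOn_inv_norm_pow μ (measurableSet_far a s) (x := x) (half_pos hs)
    (fun y hy => half_le_norm_sub_of_far hx hy) (d - 2)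
  rw [rieszPotential, nearPotential, farPotential,
    ofReal_integral_eq_lintegral_ofReal hint (Eventually.of_forall fun y => by positivity),
    ← lintegral_add_compl _ (measurableSet_far a s), add_comm]
  congr 1
  refine setLIntegral_congr_fun (measurableSet_far a s) fun y hy => ?_
  have hpos : 0 < ‖x - y‖ := (half_pos hs).trans_le (half_le_norm_sub_of_far hx hy)
  rw [ENNReal.ofReal_inv_of_pos (by positivity), ENNReal.ofReal_pow hpos.le, ofReal_norm]

theorem farPotential_nonneg (μ : Measure 𝔼) (a : 𝔼) (s : ℝ) (x : 𝔼) :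
    0 ≤ farPotential μ a s x := integral_nonneg fun y => by positivity

theorem integrableOn_riesz (μ : Measure 𝔼) [IsFiniteMeasure μ] (hd : 3 ≤ d) (a : 𝔼) {s : ℝ}
    (hs : 0 < s) :
    IntegrableOn (fun y => (‖a - y‖ ^ d)⁻¹ • (a - y)) {y | s < ‖y - a‖} μ := by
  refine Measure.integrableOn_of_bounded (M := (s ^ (d - 1))⁻¹) (measure_ne_top _ _) ?_ ?_
  · exact (by fun_prop : Measurable fun y => (‖a - y‖ ^ d)⁻¹ • (a - y)).aestronglyMeasurable
  · refine ae_restrict_of_forall_mem (measurableSet_far a s) fun y hy => ?_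
    have hy' : s < ‖a - y‖ := by rw [norm_sub_rev]; exact hy
    have hpos : 0 < ‖a - y‖ := hs.trans hy'
    rw [norm_smul, Real.norm_of_nonneg (by positivity)]
    have : (‖a - y‖ ^ d)⁻¹ * ‖a - y‖ = (‖a - y‖ ^ (d - 1))⁻¹ := by
      have : ‖a - y‖ ^ d = ‖a - y‖ ^ (d - 1) * ‖a - y‖ := by
        rw [← pow_succ]; congr 1; omega
      rw [this]; field_simp
    rw [this]
    gcongr

/-- The constant in the Taylor expansion of the kernel. -/
def taylorConst (d : ℕ) : ℝ := 4 * ((d - 2 : ℕ) * 2 ^ (d - 2)) + 6 * (d - 2 : ℕ)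

theorem taylorConst_nonneg (d : ℕ) : 0 ≤ taylorConst d := by
  unfold taylorConst; positivity

/-- Integrate the kernel expansion with `z = a - y`, `h = x - a`; on the far region `‖z‖ > s ≥
2‖h‖`. -/
theorem abs_farPotential_taylor_le (μ : Measure 𝔼) [IsFiniteMeasure μ] (hd : 3 ≤ d) {a x : 𝔼}
    {s : ℝ} (hs : 0 < s) (hx : 2 * ‖x - a‖ ≤ s) :
    |farPotential μ a s x - farPotential μ a s a +
      (d - 2 : ℕ) * inner ℝ (truncatedRiesz μ a s) (x - a)| ≤
      taylorConst d * ‖x - a‖ ^ 2 * tailIntegral μ a s := by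
  have hfar := measurableSet_far a s
  have hfa : ∀ y ∈ {y : 𝔼 | s < ‖y - a‖}, s ≤ ‖a - y‖ := fun y hy => by
    rw [norm_sub_rev]; exact le_of_lt hy
  have i1 := integrableOn_inv_norm_pow μ hfar (x := x) (half_pos hs)
    (fun y hy => half_le_norm_sub_of_far hx hy) (d - 2)
  have i2 := integrableOn_inv_norm_pow μ hfar (x := a) hs hfa (d - 2)
  have i3 := integrableOn_inv_norm_pow μ hfar (x := a) hs hfa d
  have i4 := integrableOn_riesz μ hd a hs
  have i5 : IntegrableOn (fun y => inner ℝ (x - a) ((‖a - y‖ ^ d)⁻¹ • (a - y)))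
    {y | s < ‖y - a‖} μ := i4.const_inner (x - a)
  have e : farPotential μ a s x - farPotential μ a s a +
      (d - 2 : ℕ) * inner ℝ (truncatedRiesz μ a s) (x - a) =
      ∫ y in {y | s < ‖y - a‖}, ((‖x - y‖ ^ (d - 2))⁻¹ - (‖a - y‖ ^ (d - 2))⁻¹ +
        (d - 2 : ℕ) * inner ℝ (x - a) ((‖a - y‖ ^ d)⁻¹ • (a - y))) ∂μ := by
    rw [integral_add (f := fun y => (‖x - y‖ ^ (d - 2))⁻¹ - (‖a - y‖ ^ (d - 2))⁻¹) (i1.sub i2)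
      (i5.const_mul _), integral_sub i1 i2, integral_const_mul,
      integral_inner i4, real_inner_comm]
    rfl
  rw [e, tailIntegral, ← integral_const_mul, ← Real.norm_eq_abs]
  refine norm_integral_le_of_norm_le (i3.const_mul _) ?_
  refine ae_restrict_of_forall_mem hfar fun y hy => ?_
  have hz : s < ‖a - y‖ := by rw [norm_sub_rev]; exact hy
  have := abs_inv_norm_pow_taylor_le (d - 2) (z := a - y) (h := x - a)
    (norm_pos_iff.1 (hs.trans hz)) (hx.trans hz.le)
  rw [show a - y + (x - a) = x - y by abel, show d - 2 + 2 = d by omega] at this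
  rw [Real.norm_eq_abs, inner_smul_right, real_inner_comm]
  exact this

variable (μ : Measure (EuclideanSpace ℝ (Fin d))) (a : EuclideanSpace ℝ (Fin d)) (A : Fin d → ℝ)

/-- The affine remainder of the potential, as a real number. -/
def remainder (x : 𝔼) : ℝ :=
  (rieszPotential μ x).toReal - (rieszPotential μ a).toReal - ∑ i, A i * (x i - a i)

/-- The discrepancy between the linear coefficient of the far potential and the candidate
gradient. -/
def gradientDefect (s : ℝ) : 𝔼 :=
  -(((d - 2 : ℕ) : ℝ) • truncatedRiesz μ a s) - WithLp.toLp 2 A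

theorem sum_mul_sub_eq_inner (x : 𝔼) :
    ∑ i, A i * (x i - a i) = inner ℝ (WithLp.toLp 2 A : 𝔼) (x - a) := by
  simp [PiLp.inner_apply, mul_comm]

variable {μ a A}

/-- The far part contributes its Taylor error and the near part is bounded by its values at `x` and
`a`. This controls the remainder by the gradient defect, and conversely. -/
theorem abs_remainder_sub_inner_le [IsFiniteMeasure μ] (hd : 3 ≤ d) {x : 𝔼} {s : ℝ} (hs : 0 < s)
    (hx : 2 * ‖x - a‖ ≤ s) (ha : rieszPotential μ a ≠ ∞) (hux : rieszPotential μ x ≠ ∞) :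
    |remainder μ a A x - inner ℝ (gradientDefect μ a A s) (x - a)| ≤
      (nearPotential μ a s x).toReal + (nearPotential μ a s a).toReal +
      taylorConst d * ‖x - a‖ ^ 2 * tailIntegral μ a s := by
  have ex := rieszPotential_eq_near_add_far μ hs hx
  have ea := rieszPotential_eq_near_add_far μ (a := a) (x := a) hs (by simpa using hs.le)
  have nx : nearPotential μ a s x ≠ ∞ := fun h => hux (by rw [ex, h, top_add])
  have na : nearPotential μ a s a ≠ ∞ := fun h => ha (by rw [ea, h, top_add])
  have tx : (rieszPotential μ x).toReal =
      (nearPotential μ a s x).toReal + farPotential μ a s x := by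
    rw [ex, ENNReal.toReal_add nx ENNReal.ofReal_ne_top,
      ENNReal.toReal_ofReal (farPotential_nonneg _ _ _ _)]
  have ta : (rieszPotential μ a).toReal =
      (nearPotential μ a s a).toReal + farPotential μ a s a := by
    rw [ea, ENNReal.toReal_add na ENNReal.ofReal_ne_top,
      ENNReal.toReal_ofReal (farPotential_nonneg _ _ _ _)]
  have ht := abs_farPotential_taylor_le μ hd hs hx
  have p1 : 0 ≤ (nearPotential μ a s x).toReal := ENNReal.toReal_nonneg
  have p2 : 0 ≤ (nearPotential μ a s a).toReal := ENNReal.toReal_nonneg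
  rw [remainder, sum_mul_sub_eq_inner, tx, ta, gradientDefect, inner_sub_left, inner_neg_left,
    real_inner_smul_left]
  rw [abs_le] at ht ⊢
  constructor <;> linarith [ht.1, ht.2]

theorem remainderQuotient_eq {x : 𝔼} (ha : rieszPotential μ a ≠ ∞)
    (hx : rieszPotential μ x ≠ ∞) :
    remainderQuotient (fun x => (rieszPotential μ x : EReal)) a A x =
      ENNReal.ofReal |remainder μ a A x| / ‖x - a‖ₑ := by
  rw [remainderQuotient, remainder]
  congr 1
  lift rieszPotential μ a to ℝ≥0 using ha with p
  lift rieszPotential μ x to ℝ≥0 using hx with q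
  have e : ∀ b : ℝ≥0, (((b : ℝ≥0∞) : EReal)) = ((b : ℝ) : EReal) := fun b => rfl
  rw [e, e, ← EReal.coe_sub, ← EReal.coe_sub, EReal.abs_def, ENNReal.coe_toReal, ENNReal.coe_toReal]

theorem remainderQuotient_le [IsFiniteMeasure μ] (hd : 3 ≤ d) {x : 𝔼} {s : ℝ} (hs : 0 < s)
    (hxa : x ≠ a) (hx : 2 * ‖x - a‖ ≤ s) (ha : rieszPotential μ a ≠ ∞) :
    remainderQuotient (fun x => (rieszPotential μ x : EReal)) a A x ≤
      nearPotential μ a s x / ‖x - a‖ₑ +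
      ENNReal.ofReal ((nearPotential μ a s a).toReal / ‖x - a‖ +
        taylorConst d * ‖x - a‖ * tailIntegral μ a s + ‖gradientDefect μ a A s‖) := by
  have hpos : 0 < ‖x - a‖ := norm_pos_iff.2 (sub_ne_zero.2 hxa)
  have hn : ‖x - a‖ₑ = ENNReal.ofReal ‖x - a‖ := (ofReal_norm _).symm
  -- If the potential is infinite at `x`, so is the near part, and the bound is trivial.
  by_cases hux : rieszPotential μ x = ∞
  · have ex := rieszPotential_eq_near_add_far μ hs hx
    rw [hux] at ex
    have : nearPotential μ a s x = ∞ := by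
      by_contra h
      exact (ENNReal.add_lt_top.2 ⟨lt_top_iff_ne_top.2 h, ENNReal.ofReal_lt_top⟩).ne ex.symm
    rw [this, ENNReal.top_div_of_ne_top (by simp)]
    simp
  rw [remainderQuotient_eq ha hux]
  have nx : nearPotential μ a s x ≠ ∞ := fun h => hux (by
    rw [rieszPotential_eq_near_add_far μ hs hx, h, top_add])
  have key := abs_remainder_sub_inner_le (A := A) hd hs hx ha hux
  have hin : |inner ℝ (gradientDefect μ a A s) (x - a)| ≤ ‖gradientDefect μ a A s‖ * ‖x - a‖ :=
    abs_real_inner_le_norm _ _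
  have hb : |remainder μ a A x| ≤ (nearPotential μ a s x).toReal +
      ((nearPotential μ a s a).toReal / ‖x - a‖ +
        taylorConst d * ‖x - a‖ * tailIntegral μ a s + ‖gradientDefect μ a A s‖) * ‖x - a‖ := by
    have := abs_sub_abs_le_abs_sub (remainder μ a A x) (inner ℝ (gradientDefect μ a A s) (x - a))
    have e : (nearPotential μ a s a).toReal / ‖x - a‖ * ‖x - a‖ =
      (nearPotential μ a s a).toReal := by field_simp
    nlinarith
  have h0 : 0 ≤ tailIntegral μ a s := integral_nonneg fun y => by positivity
  have h1 := taylorConst_nonneg d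
  rw [hn, ENNReal.div_le_iff (by simpa using hpos) (by simp), add_mul,
    ENNReal.div_mul_cancel (by simpa using hpos) (by simp),
    ← ENNReal.ofReal_mul (by positivity), ← ENNReal.ofReal_toReal nx,
    ← ENNReal.ofReal_add (by positivity) (by positivity)]
  exact ENNReal.ofReal_le_ofReal hb

/-- The splitting inequality solved for the gradient defect, as needed for necessity. -/
theorem abs_inner_gradientDefect_le [IsFiniteMeasure μ] (hd : 3 ≤ d) {x : 𝔼} {s : ℝ} (hs : 0 < s)
    (hx : 2 * ‖x - a‖ ≤ s) (ha : rieszPotential μ a ≠ ∞) (hux : rieszPotential μ x ≠ ∞) :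
    ENNReal.ofReal |inner ℝ (gradientDefect μ a A s) (x - a)| ≤
      ENNReal.ofReal |remainder μ a A x| + nearPotential μ a s x +
      ENNReal.ofReal ((nearPotential μ a s a).toReal +
        taylorConst d * ‖x - a‖ ^ 2 * tailIntegral μ a s) := by
  have nx : nearPotential μ a s x ≠ ∞ := fun h => hux (by
    rw [rieszPotential_eq_near_add_far μ hs hx, h, top_add])
  have key := abs_remainder_sub_inner_le (A := A) hd hs hx ha hux
  have h0 : 0 ≤ tailIntegral μ a s := integral_nonneg fun y => by positivity
  have h1 := taylorConst_nonneg d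
  rw [← ENNReal.ofReal_toReal nx, ← ENNReal.ofReal_add (by positivity) (by positivity),
    ← ENNReal.ofReal_add (by positivity) (by positivity)]
  refine ENNReal.ofReal_le_ofReal ?_
  have := abs_sub_abs_le_abs_sub (inner ℝ (gradientDefect μ a A s) (x - a)) (remainder μ a A x)
  rw [abs_sub_comm] at this
  linarith

end

/-! ### Consequences of small growth at the point -/

section

theorem eventually_nhdsGT_forall_le {P : ℝ → Prop} (h : ∀ᶠ r in 𝓝[>] (0 : ℝ), P r) :
    ∃ δ > 0, ∀ s, 0 < s → s < δ → P s := by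
  obtain ⟨δ, hδ, h⟩ := (mem_nhdsGT_iff_exists_Ioo_subset).1 h
  exact ⟨δ, hδ, fun s h0 h1 => h ⟨h0, h1⟩⟩

theorem eventually_nhdsGT_mul {P : ℝ → Prop} (h : ∀ᶠ r in 𝓝[>] (0 : ℝ), P r) {c : ℝ}
    (hc : 0 < c) : ∀ᶠ r in 𝓝[>] (0 : ℝ), P (c * r) := by
  obtain ⟨δ, hδ, h⟩ := eventually_nhdsGT_forall_le h
  filter_upwards [Ioo_mem_nhdsGT (div_pos hδ hc)] with r hr
  refine h _ (mul_pos hc hr.1) ?_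
  have := hr.2
  rwa [lt_div_iff₀ hc, mul_comm] at this

/-- The measure of the ball of radius `r` at `a` is `o(r ^ (d - 1))`. -/
def SmallGrowth (μ : Measure (EuclideanSpace ℝ (Fin d))) (a : EuclideanSpace ℝ (Fin d)) : Prop :=
  Tendsto (fun r : ℝ => μ.real (Metric.ball a r) / r ^ (d - 1)) (𝓝[>] 0) (𝓝 0)

theorem SmallGrowth.exists_forall_le {μ : Measure 𝔼} [IsFiniteMeasure μ] {a : 𝔼}
    (h : SmallGrowth μ a) {ε : ℝ} (hε : 0 < ε) :
    ∃ δ > 0, ∀ s, 0 < s → s < δ → μ (Metric.ball a s) ≤ ENNReal.ofReal (ε * s ^ (d - 1)) := by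
  refine eventually_nhdsGT_forall_le ?_
  filter_upwards [h.eventually_lt_const hε, self_mem_nhdsWithin] with r hr (hr0 : 0 < r)
  rw [div_lt_iff₀ (by positivity)] at hr
  rw [← ofReal_measureReal]
  exact ENNReal.ofReal_le_ofReal hr.le

theorem smallGrowth_of_eventually {μ : Measure 𝔼} {a : 𝔼}
    (h : ∀ ε : ℝ, 0 < ε → ∀ᶠ r in 𝓝[>] (0 : ℝ),
      μ (Metric.ball a r) ≤ ENNReal.ofReal (ε * r ^ (d - 1))) : SmallGrowth μ a := by
  refine Metric.tendsto_nhds.2 fun ε hε => ?_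
  filter_upwards [h (ε / 2) (half_pos hε), self_mem_nhdsWithin] with r hr (hr0 : 0 < r)
  rw [Real.dist_eq, sub_zero, abs_of_nonneg (by positivity), div_lt_iff₀ (by positivity)]
  have : μ.real (Metric.ball a r) ≤ ε / 2 * r ^ (d - 1) :=
    ENNReal.toReal_le_of_le_ofReal (by positivity) hr
  have : 0 < ε * r ^ (d - 1) := by positivity
  linarith

variable {μ : Measure (EuclideanSpace ℝ (Fin d))} [IsFiniteMeasure μ]
  {a : EuclideanSpace ℝ (Fin d)}

theorem SmallGrowth.eventually_lintegral_kernel_le (hd : 3 ≤ d) (h : SmallGrowth μ a) {ε : ℝ}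
    (hε : 0 < ε) :
    ∀ᶠ r in 𝓝[>] (0 : ℝ), ∫⁻ y in Metric.ball a r, (‖a - y‖ₑ ^ (d - 2))⁻¹ ∂μ ≤
      ENNReal.ofReal (ε * r) := by
  obtain ⟨δ, hδ, hb⟩ := h.exists_forall_le (ε := ε / 2 ^ (d - 2 + 1)) (by positivity)
  filter_upwards [Ioo_mem_nhdsGT hδ] with r hr
  refine (lintegral_ball_inv_enorm_pow_le μ a (d - 2) 1 le_rfl
    (M := ε / 2 ^ (d - 2 + 1)) (by positivity) hr.1 ?_).trans (le_of_eq ?_)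
  · intro s hs hsr
    rw [show d - 2 + 1 = d - 1 by omega] at hb ⊢
    exact hb s hs (hsr.trans_lt hr.2)
  · rw [pow_one]; congr 1; field_simp

theorem SmallGrowth.eventually_nearPotential_le (hd : 3 ≤ d) (h : SmallGrowth μ a) {ε : ℝ}
    (hε : 0 < ε) :
    ∀ᶠ s in 𝓝[>] (0 : ℝ), nearPotential μ a s a ≤ ENNReal.ofReal (ε * s) := by
  filter_upwards [eventually_nhdsGT_mul (h.eventually_lintegral_kernel_le hd (half_pos hε))
    two_pos, self_mem_nhdsWithin] with s hs (hs0 : 0 < s)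
  rw [show ε / 2 * (2 * s) = ε * s by ring] at hs
  refine (lintegral_mono_set fun y hy => ?_).trans hs
  simp only [mem_compl_iff, mem_ofPred_eq, not_lt] at hy
  rw [Metric.mem_ball, dist_eq_norm]
  linarith

theorem SmallGrowth.rieszPotential_ne_top (hd : 3 ≤ d) (h : SmallGrowth μ a) :
    rieszPotential μ a ≠ ∞ := by
  obtain ⟨s, hs, hs0⟩ := ((h.eventually_nearPotential_le hd one_pos).and
    self_mem_nhdsWithin).exists
  rw [rieszPotential_eq_near_add_far μ (a := a) (x := a) (s := s) hs0
    (by simpa using le_of_lt hs0)]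
  exact ENNReal.add_ne_top.2 ⟨ne_top_of_le_ne_top ENNReal.ofReal_ne_top hs, ENNReal.ofReal_ne_top⟩

/-- In `B(a,r)` one has `‖a - y‖⁻¹ ≤ r^(d-3) ‖a - y‖^(2-d)`, which reduces this to the kernel
integral. -/
theorem SmallGrowth.eventually_lintegral_inv_le (hd : 3 ≤ d) (h : SmallGrowth μ a) {ε : ℝ}
    (hε : 0 < ε) :
    ∀ᶠ r in 𝓝[>] (0 : ℝ), ∫⁻ y in Metric.ball a r, ‖a - y‖ₑ⁻¹ ∂μ ≤
      ENNReal.ofReal (ε * r ^ (d - 2)) := by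
  filter_upwards [h.eventually_lintegral_kernel_le hd hε, self_mem_nhdsWithin] with r hr
    (hr0 : 0 < r)
  calc ∫⁻ y in Metric.ball a r, ‖a - y‖ₑ⁻¹ ∂μ
      ≤ ∫⁻ y in Metric.ball a r, ENNReal.ofReal (r ^ (d - 3)) * (‖a - y‖ₑ ^ (d - 2))⁻¹ ∂μ := by
        refine setLIntegral_mono' measurableSet_ball fun y hy => ?_
        rw [Metric.mem_ball, dist_comm, dist_eq_norm] at hy
        by_cases h0 : ‖a - y‖ₑ = 0
        · rw [h0, zero_pow (by omega), ENNReal.inv_zero, ENNReal.mul_top]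
          simp; positivity
        have e : ‖a - y‖ₑ⁻¹ = ‖a - y‖ₑ ^ (d - 3) * (‖a - y‖ₑ ^ (d - 2))⁻¹ := by
          rw [show d - 2 = d - 3 + 1 by omega, pow_succ,
            ENNReal.mul_inv (Or.inr enorm_ne_top) (Or.inr h0), ← mul_assoc,
            ENNReal.mul_inv_cancel (pow_ne_zero _ h0) (ENNReal.pow_ne_top enorm_ne_top), one_mul]
        rw [e, ENNReal.ofReal_pow hr0.le]
        gcongr
        rw [← ofReal_norm]
        exact ENNReal.ofReal_le_ofReal hy.le
    _ = ENNReal.ofReal (r ^ (d - 3)) * ∫⁻ y in Metric.ball a r, (‖a - y‖ₑ ^ (d - 2))⁻¹ ∂μ := by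
        rw [lintegral_const_mul' _ _ ENNReal.ofReal_ne_top]
    _ ≤ ENNReal.ofReal (r ^ (d - 3)) * ENNReal.ofReal (ε * r) := by gcongr
    _ = _ := by
        rw [← ENNReal.ofReal_mul (by positivity), show d - 2 = d - 3 + 1 by omega, pow_succ]
        congr 1; ring

/-- Mass near `a` contributes a small multiple of `1/s` by the dyadic bound; mass outside a fixed
ball contributes a constant, which is negligible against `1/s`. -/
theorem SmallGrowth.eventually_tailIntegral_le (hd : 3 ≤ d) (h : SmallGrowth μ a) {ε : ℝ}
    (hε : 0 < ε) : ∀ᶠ s in 𝓝[>] (0 : ℝ), tailIntegral μ a s ≤ ε / s := by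
  set ε' := ε / (2 * 2 ^ d) with hε'
  have hε'0 : 0 < ε' := by positivity
  obtain ⟨δ, hδ, hb⟩ := h.exists_forall_le hε'0
  set r := δ / 2 with hr
  have hr0 : 0 < r := by positivity
  set T := (r ^ d)⁻¹ * μ.real univ with hT
  have hT0 : 0 ≤ T := by positivity
  filter_upwards [Ioo_mem_nhdsGT (show 0 < ε / 2 / (T + 1) by positivity)] with s hs
  obtain ⟨hs0, hs1⟩ := hs
  rw [lt_div_iff₀ (by positivity)] at hs1
  have hfs := measurableSet_far a s
  -- Restricting `μ` to `B(a, δ/2)` extends the growth bound to all radii, as the dyadic estimate at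
  -- infinity requires.
  have hgrow : ∀ t, 0 < t → (μ.restrict (Metric.ball a r)) (Metric.ball a t) ≤
      ENNReal.ofReal (ε' * t ^ (d - 1)) := by
    intro t ht
    rw [Measure.restrict_apply measurableSet_ball]
    rcases lt_or_ge t δ with h1 | h1
    · exact (measure_mono inter_subset_left).trans (hb t ht h1)
    · refine (measure_mono inter_subset_right).trans ((hb r hr0 (by linarith)).trans ?_)
      apply ENNReal.ofReal_le_ofReal
      have : r ≤ t := by linarith
      gcongr
  have h1 := lintegral_compl_ball_inv_enorm_pow_le (μ.restrict (Metric.ball a r)) a (d - 1)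
    hε'0.le hs0 hgrow
  rw [show d - 1 + 1 = d by omega] at h1
  have e : ENNReal.ofReal (tailIntegral μ a s) ≤
      ∫⁻ y in {y | s ≤ ‖a - y‖}, (‖a - y‖ₑ ^ d)⁻¹ ∂μ := by
    rw [tailIntegral, ofReal_integral_eq_lintegral_ofReal
      (integrableOn_inv_norm_pow μ hfs hs0 (fun y hy => by
        rw [norm_sub_rev]; exact le_of_lt hy) d)
      (Eventually.of_forall fun y => by positivity)]
    calc ∫⁻ y in {y | s < ‖y - a‖}, ENNReal.ofReal ((‖a - y‖ ^ d)⁻¹) ∂μ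
        ≤ ∫⁻ y in {y | s < ‖y - a‖}, (‖a - y‖ₑ ^ d)⁻¹ ∂μ := by
          refine setLIntegral_mono' hfs fun y hy => ?_
          have hy' : s < ‖y - a‖ := hy
          exact le_inv_enorm_pow (by rw [norm_sub_rev]; linarith) le_rfl d
      _ ≤ _ := lintegral_mono_set fun y hy => by
          rw [mem_ofPred_eq, norm_sub_rev]; exact le_of_lt hy
  have hms : MeasurableSet {y : 𝔼 | s ≤ ‖a - y‖} :=
    measurableSet_le (by fun_prop) (by fun_prop)
  have e2 : ∫⁻ y in {y | s ≤ ‖a - y‖}, (‖a - y‖ₑ ^ d)⁻¹ ∂μ ≤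
      ENNReal.ofReal (2 ^ d * ε' / s) + ENNReal.ofReal T := by
    rw [← lintegral_inter_add_sdiff _ _ (measurableSet_ball (x := a) (ε := r))]
    refine add_le_add ?_ ?_
    · refine le_trans (le_of_eq ?_) h1
      rw [Measure.restrict_restrict hms]
    · calc ∫⁻ y in {y | s ≤ ‖a - y‖} \ Metric.ball a r, (‖a - y‖ₑ ^ d)⁻¹ ∂μ
          ≤ ∫⁻ y in {y | s ≤ ‖a - y‖} \ Metric.ball a r, ENNReal.ofReal ((r ^ d)⁻¹) ∂μ := by
            refine setLIntegral_mono' (hms.diff measurableSet_ball) fun y hy => ?_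
            refine inv_enorm_pow_le hr0 ?_ _
            have := hy.2
            rwa [Metric.mem_ball, dist_comm, dist_eq_norm, not_lt] at this
        _ = ENNReal.ofReal ((r ^ d)⁻¹) * μ ({y | s ≤ ‖a - y‖} \ Metric.ball a r) :=
            setLIntegral_const _ _
        _ ≤ ENNReal.ofReal ((r ^ d)⁻¹) * μ univ := by gcongr; exact subset_univ _
        _ = ENNReal.ofReal T := by
            rw [hT, ENNReal.ofReal_mul (by positivity), ofReal_measureReal]
  have e3 := e.trans e2
  rw [← ENNReal.ofReal_add (by positivity) hT0,
    ENNReal.ofReal_le_ofReal_iff (by positivity)] at e3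
  refine e3.trans ?_
  have e4 : 2 ^ d * ε' / s = ε / s / 2 := by rw [hε']; field_simp
  have e5 : T ≤ ε / s / 2 := by
    rw [div_div, le_div_iff₀ (by positivity)]
    nlinarith
  linarith

end

/-! ### Sufficiency: integrating against admissible measures -/

section

theorem tendsto_zero_of_forall_le_ofReal {α : Type*} {l : Filter α} {f : α → ℝ≥0∞}
    (h : ∀ ε : ℝ, 0 < ε → ∀ᶠ x in l, f x ≤ ENNReal.ofReal ε) : Tendsto f l (𝓝 0) := by
  refine ENNReal.tendsto_nhds_zero.2 fun ε hε => ?_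
  obtain ⟨b, hb0, hb⟩ := ENNReal.lt_iff_exists_nnreal_btwn.1 hε
  filter_upwards [h b (by exact_mod_cast hb0)] with x hx
  exact hx.trans (by simpa using hb.le)

/-- The near part of the potential divided by the distance to `a` is integrated against an
admissible measure by exchanging the order of integration. -/
theorem lintegral_nearPotential_div_le (μ : Measure 𝔼) [IsFiniteMeasure μ] (a : 𝔼) {r : ℝ}
    {K : Set 𝔼} (hKm : MeasurableSet K) (hK : K ⊆ Metric.ball a r) (σ : Measure 𝔼)
    [IsFiniteMeasure σ] (hσ : ∀ x, rieszPotential σ x ≤ 1) :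
    ∫⁻ x in K, nearPotential μ a (2 * ‖x - a‖) x / ‖x - a‖ₑ ∂σ ≤
      2 * ∫⁻ y in Metric.ball a (2 * r), ‖a - y‖ₑ⁻¹ ∂μ := by
  set S : Set (𝔼 × 𝔼) := {p | ‖p.2 - a‖ ≤ 2 * ‖p.1 - a‖} with hS
  have hSm : MeasurableSet S := measurableSet_le (by fun_prop) (by fun_prop)
  set F : 𝔼 × 𝔼 → ℝ≥0∞ :=
    S.indicator (fun p => (‖p.1 - p.2‖ₑ ^ (d - 2))⁻¹ * ‖p.1 - a‖ₑ⁻¹) with hF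
  have hFm : Measurable F := Measurable.indicator (by fun_prop) hSm
  have e1 : ∀ x, nearPotential μ a (2 * ‖x - a‖) x / ‖x - a‖ₑ = ∫⁻ y, F (x, y) ∂μ := by
    intro x
    have hm := (measurableSet_far a (2 * ‖x - a‖)).compl
    rw [nearPotential, div_eq_mul_inv, ← lintegral_mul_const _ (by fun_prop),
      ← lintegral_indicator hm]
    refine lintegral_congr fun y => ?_
    simp only [hF, indicator, hS, mem_compl_iff, mem_ofPred_eq, not_lt]
  simp_rw [e1]
  rw [lintegral_lintegral_swap (f := fun x y => F (x, y)) hFm.aemeasurable,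
    ← lintegral_const_mul _ (by fun_prop), ← lintegral_indicator measurableSet_ball]
  refine lintegral_mono fun y => ?_
  by_cases hy : y ∈ Metric.ball a (2 * r)
  · rw [indicator_of_mem hy]
    -- On `S` the factor `‖x - a‖⁻¹` is at most `2‖a - y‖⁻¹`; by symmetry of the kernel, what is
    -- left is the potential of `σ` at `y`.
    calc ∫⁻ x in K, F (x, y) ∂σ
        ≤ ∫⁻ x, (2 * ‖a - y‖ₑ⁻¹) * (‖y - x‖ₑ ^ (d - 2))⁻¹ ∂σ := by
          refine (setLIntegral_le_lintegral _ _).trans (lintegral_mono fun x => ?_)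
          refine indicator_apply_le' (fun hxy => ?_) fun _ => zero_le
          have hxy : ‖y - a‖ ≤ 2 * ‖x - a‖ := hxy
          have h2 : ‖y - a‖ₑ ≤ 2 * ‖x - a‖ₑ := by
            rw [← ofReal_norm, ← ofReal_norm]
            refine (ENNReal.ofReal_le_ofReal hxy).trans_eq ?_
            rw [ENNReal.ofReal_mul (by norm_num), ENNReal.ofReal_ofNat]
          simp only
          rw [mul_comm, enorm_sub_rev x y, enorm_sub_rev a y]
          gcongr
          calc ‖x - a‖ₑ⁻¹ = 2 * (2 * ‖x - a‖ₑ)⁻¹ := by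
                rw [ENNReal.mul_inv (by simp) (by simp), ← mul_assoc,
                  ENNReal.mul_inv_cancel (by simp) (by simp), one_mul]
            _ ≤ 2 * ‖y - a‖ₑ⁻¹ := by gcongr
      _ = (2 * ‖a - y‖ₑ⁻¹) * rieszPotential σ y := by
          rw [lintegral_const_mul _ (by fun_prop)]; rfl
      _ ≤ (2 * ‖a - y‖ₑ⁻¹) * 1 := by gcongr; exact hσ y
      _ = _ := mul_one _
  · rw [indicator_of_notMem hy, nonpos_iff_eq_zero]
    refine (setLIntegral_congr_fun hKm fun x hx => ?_).trans lintegral_zero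
    refine indicator_of_notMem (fun hxy => hy ?_) _
    have hxy : ‖y - a‖ ≤ 2 * ‖x - a‖ := hxy
    have hx := hK hx
    rw [Metric.mem_ball, dist_eq_norm] at hx ⊢
    linarith

variable {μ : Measure (EuclideanSpace ℝ (Fin d))} [IsFiniteMeasure μ]
  {a : EuclideanSpace ℝ (Fin d)} {A : Fin d → ℝ}

/-- Choosing the cut `s = 2‖x - a‖`, which varies with `x`, makes every error other than the near
potential at `x` small relative to `‖x - a‖`. -/
theorem eventually_remainderQuotient_le (hd : 3 ≤ d) (hg : SmallGrowth μ a)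
    (hA : Tendsto (gradientDefect μ a A) (𝓝[>] 0) (𝓝 0)) {ε : ℝ} (hε : 0 < ε) :
    ∀ᶠ r in 𝓝[>] (0 : ℝ), ∀ x ∈ Metric.ball a r, x ≠ a →
      remainderQuotient (fun x => (rieszPotential μ x : EReal)) a A x ≤
        nearPotential μ a (2 * ‖x - a‖) x / ‖x - a‖ₑ + ENNReal.ofReal ε := by
  set C := taylorConst d with hC
  have hC0 : 0 ≤ C := taylorConst_nonneg d
  -- The three errors are at most `2η` (near potential at `a`), `C * η` (Taylor) and `η` (gradient
  -- defect).
  set η := ε / (C + 3) with hη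
  have hη0 : 0 < η := by positivity
  have hA' : ∀ᶠ s in 𝓝[>] (0 : ℝ), ‖gradientDefect μ a A s‖ < η := by
    have := hA.norm
    rw [norm_zero] at this
    exact this.eventually_lt_const hη0
  obtain ⟨δ, hδ, h⟩ := eventually_nhdsGT_forall_le
    ((hg.eventually_nearPotential_le hd hη0).and
      ((hg.eventually_tailIntegral_le hd hη0).and hA'))
  filter_upwards [Ioo_mem_nhdsGT (half_pos hδ)] with r hr x hx hxa
  have hpos : 0 < ‖x - a‖ := norm_pos_iff.2 (sub_ne_zero.2 hxa)
  rw [Metric.mem_ball, dist_eq_norm] at hx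
  obtain ⟨h1, h2, h3⟩ := h (2 * ‖x - a‖) (by positivity) (by linarith [hr.2])
  refine (remainderQuotient_le hd (s := 2 * ‖x - a‖) (by positivity) hxa le_rfl
    (hg.rieszPotential_ne_top hd)).trans ?_
  gcongr
  have h1' : (nearPotential μ a (2 * ‖x - a‖) a).toReal / ‖x - a‖ ≤ 2 * η := by
    rw [div_le_iff₀ hpos]
    refine (ENNReal.toReal_le_of_le_ofReal (by positivity) h1).trans (le_of_eq (by ring))
  have h2' : C * ‖x - a‖ * tailIntegral μ a (2 * ‖x - a‖) ≤ C * η := by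
    rw [mul_assoc]
    refine mul_le_mul_of_nonneg_left ?_ hC0
    rw [le_div_iff₀ (by positivity)] at h2
    have : 0 ≤ tailIntegral μ a (2 * ‖x - a‖) := integral_nonneg fun y => by positivity
    nlinarith
  have : ε = (C + 3) * η := by rw [hη]; field_simp
  rw [this]
  linarith

/-- Sufficiency: small growth and convergence of the truncated Riesz transforms give
differentiability in the capacity sense. -/
theorem differentiableAtCap_of_smallGrowth (hd : 3 ≤ d) (hg : SmallGrowth μ a)
    (hA : Tendsto (gradientDefect μ a A) (𝓝[>] 0) (𝓝 0)) :
    DifferentiableAtCap (fun x => (rieszPotential μ x : EReal)) a := by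
  refine ⟨by simpa using hg.rieszPotential_ne_top hd, by simp, A, ?_⟩
  obtain ⟨c, hc, hcap⟩ := exists_le_newtonianCap_ball hd
  refine tendsto_zero_of_forall_le_ofReal fun ε hε => ?_
  -- The singular part costs `2η r^(d-2)` and the uniform error `η r^(d-2)`; their sum is `ε * c *
  -- r^(d-2) ≤ ε Cap(B(a,r))`.
  set η := ε * c / 3 with hη
  have hη0 : 0 < η := by positivity
  filter_upwards [eventually_remainderQuotient_le (A := A) hd hg hA hη0,
    eventually_nhdsGT_mul (hg.eventually_lintegral_inv_le hd
      (show 0 < η / 2 ^ (d - 2) by positivity)) two_pos, self_mem_nhdsWithin] with r h1 h2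
      (hr : 0 < r)
  have hB : η / 2 ^ (d - 2) * (2 * r) ^ (d - 2) = η * r ^ (d - 2) := by
    rw [mul_pow]; field_simp
  rw [hB] at h2
  rw [ENNReal.div_le_iff]
  rotate_left
  · exact (lt_of_lt_of_le (by simp; positivity) (hcap a r hr)).ne'
  · exact ne_top_of_le_ne_top ENNReal.ofReal_ne_top (newtonianCap_ball_le a hr)
  refine le_trans (iSup₂_le fun t ht => ?_)
    (show ENNReal.ofReal (3 * η * r ^ (d - 2)) ≤ _ from ?_)
  · have ht0 : (t : ℝ≥0∞) ≠ 0 := by simpa using ht.ne'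
    rw [mul_comm, ← ENNReal.le_div_iff_mul_le (Or.inl ht0) (Or.inl ENNReal.coe_ne_top)]
    refine newtonianCap_le fun K hK hKE σ hσf _ hσ => ?_
    rw [ENNReal.le_div_iff_mul_le (Or.inl ht0) (Or.inl ENNReal.coe_ne_top)]
    have hKb : K ⊆ Metric.ball a r := fun x hx => (hKE hx).1
    have hm := measure_le_of_rieszPotential_le_one hr hK hKb hσ
    -- Chebyshev's inequality for `σ`, since `t < Q` on `K`.
    calc σ K * t = ∫⁻ x in K, t ∂σ := by rw [setLIntegral_const, mul_comm]
      _ ≤ ∫⁻ x in K, (nearPotential μ a (2 * ‖x - a‖) x / ‖x - a‖ₑ + ENNReal.ofReal η) ∂σ := by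
          refine setLIntegral_mono' hK.measurableSet fun x hx => ?_
          have hxQ := (hKE hx).2
          refine hxQ.le.trans (h1 x (hKb hx) ?_)
          -- The centre is not in `K`, because `Q` vanishes there.
          rintro rfl
          have h0 := hg.rieszPotential_ne_top hd
          rw [remainderQuotient_eq h0 h0] at hxQ
          simp [remainder] at hxQ
      _ = ∫⁻ x in K, nearPotential μ a (2 * ‖x - a‖) x / ‖x - a‖ₑ ∂σ +
          ENNReal.ofReal η * σ K := by
          rw [lintegral_add_right _ measurable_const, setLIntegral_const]
      _ ≤ 2 * ENNReal.ofReal (η * r ^ (d - 2)) +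
          ENNReal.ofReal η * ENNReal.ofReal (r ^ (d - 2)) := by
          gcongr
          refine (lintegral_nearPotential_div_le μ a hK.measurableSet hKb σ hσ).trans ?_
          gcongr
      _ = ENNReal.ofReal (3 * η * r ^ (d - 2)) := by
          rw [← ENNReal.ofReal_mul hη0.le, ← ENNReal.ofReal_ofNat,
            ← ENNReal.ofReal_mul (by norm_num), ← ENNReal.ofReal_add (by positivity)
            (by positivity)]
          congr 1; ring
  · calc ENNReal.ofReal (3 * η * r ^ (d - 2))
        = ENNReal.ofReal ε * ENNReal.ofReal (c * r ^ (d - 2)) := by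
          rw [← ENNReal.ofReal_mul hε.le, hη]; congr 1; ring
      _ ≤ _ := by gcongr; exact hcap a r hr

end

/-! ### The regularized Newtonian kernel and its Laplacian -/

section Regularized

variable {E : Type*} [NormedAddCommGroup E]

/-- The smooth function `(‖x - y‖² + ε²) ^ p`. -/
def regKernel (p ε : ℝ) (y x : E) : ℝ := (‖x - y‖ ^ 2 + ε ^ 2) ^ p

theorem regKernel_base_pos {ε : ℝ} (hε : 0 < ε) (y x : E) : 0 < ‖x - y‖ ^ 2 + ε ^ 2 := by
  positivity

theorem regKernel_pos {ε : ℝ} (hε : 0 < ε) (p : ℝ) (y x : E) : 0 < regKernel p ε y x :=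
  Real.rpow_pos_of_pos (regKernel_base_pos hε y x) p

variable [InnerProductSpace ℝ E]

theorem contDiff_regKernel {ε : ℝ} (hε : 0 < ε) (p : ℝ) (y : E) :
    ContDiff ℝ 2 (regKernel p ε y) := by
  unfold regKernel
  refine ContDiff.rpow_const_of_ne ?_ fun x => (regKernel_base_pos hε y x).ne'
  exact ((contDiff_id.sub contDiff_const).norm_sq ℝ).add contDiff_const

theorem hasFDerivAt_regKernel {ε : ℝ} (hε : 0 < ε) (p : ℝ) (y x : E) :
    HasFDerivAt (regKernel p ε y)
      ((2 * p * regKernel (p - 1) ε y x) • innerSL ℝ (x - y)) x := by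
  have h1 : HasFDerivAt (fun x : E => ‖x - y‖ ^ 2 + ε ^ 2) (2 • innerSL ℝ (x - y)) x := by
    have := ((hasFDerivAt_id (𝕜 := ℝ) x).sub_const y).norm_sq.add_const (ε ^ 2)
    simpa using this
  have h2 := h1.rpow_const (p := p) (Or.inl (regKernel_base_pos hε y x).ne')
  convert! h2 using 1
  rw [regKernel]
  ext v
  simp
  ring

theorem fderiv_regKernel_apply {ε : ℝ} (hε : 0 < ε) (p : ℝ) (y x v : E) :
    fderiv ℝ (regKernel p ε y) x v = 2 * p * regKernel (p - 1) ε y x * inner ℝ (x - y) v := by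
  rw [(hasFDerivAt_regKernel hε p y x).fderiv]
  simp [inner_sub_left]

theorem fderiv_fderiv_regKernel_apply {ε : ℝ} (hε : 0 < ε) (p : ℝ) (y x v : E) :
    fderiv ℝ (fun x => fderiv ℝ (regKernel p ε y) x v) x v =
      2 * p * (regKernel (p - 1) ε y x * ‖v‖ ^ 2 +
        2 * (p - 1) * regKernel (p - 2) ε y x * (inner ℝ (x - y) v) ^ 2) := by
  have e : (fun x => fderiv ℝ (regKernel p ε y) x v) =
      fun x => (2 * p) * (regKernel (p - 1) ε y x * inner ℝ (x - y) v) := by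
    funext x; rw [fderiv_regKernel_apply hε]; ring
  have h1 : HasFDerivAt (fun x : E => inner ℝ (x - y) v) (innerSL ℝ v) x := by
    have : (fun x : E => inner ℝ (x - y) v) = fun x => innerSL ℝ v x - innerSL ℝ v y := by
      funext x; rw [← map_sub, innerSL_apply_apply, real_inner_comm]
    rw [this]
    exact (innerSL ℝ v).hasFDerivAt.sub_const _
  have h2 : HasFDerivAt
      (fun x => (2 * p) * (regKernel (p - 1) ε y x * inner ℝ (x - y) v)) _ x := ((hasFDerivAt_regKernel hε (p - 1) y x).mul h1).const_mul (2 * p)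
  rw [e, h2.fderiv]
  simp [inner_sub_left]
  rw [show p - 1 - 1 = p - 2 by ring]
  ring

/-- The Laplacian of the regularized Newtonian kernel. -/
theorem sum_fderiv_fderiv_regKernel [FiniteDimensional ℝ E] {ι : Type*} [Fintype ι]
    (b : OrthonormalBasis ι ℝ E) {ε : ℝ} (hε : 0 < ε) (y x : E) {D : ℝ}
    (hD : (Fintype.card ι : ℝ) = D) :
    ∑ i, fderiv ℝ (fun x => fderiv ℝ (regKernel ((2 - D) / 2) ε y) x (b i)) x (b i) =
      - ((D - 2) * D * ε ^ 2 * regKernel ((2 - D) / 2 - 2) ε y x) := by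
  set p := (2 - D) / 2 with hp
  have hsum : ∑ i, (inner ℝ (x - y) (b i)) ^ 2 = ‖x - y‖ ^ 2 := by
    have := b.sum_sq_norm_inner_left (x - y)
    simpa [sq_abs] using this
  have e : regKernel (p - 1) ε y x = regKernel (p - 2) ε y x * (‖x - y‖ ^ 2 + ε ^ 2) := by
    unfold regKernel
    -- Factoring out the power `p - 2` exposes the cancellation: the coefficient of `‖x - y‖²` is `D
    -- + 2(p - 1) = 0`, so only the `ε²` term survives.
    rw [← Real.rpow_add_one (regKernel_base_pos hε y x).ne']
    congr 1; ring
  simp_rw [fderiv_fderiv_regKernel_apply hε, b.norm_eq_one]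
  rw [← Finset.mul_sum, Finset.sum_add_distrib, ← Finset.mul_sum, ← Finset.mul_sum, hsum, e]
  simp only [one_pow, mul_one, Finset.sum_const, Finset.card_univ, nsmul_eq_mul, hD]
  rw [show D = 2 - 2 * p by rw [hp]; ring]
  ring

variable [MeasurableSpace E] [BorelSpace E] [FiniteDimensional ℝ E]

/-- Integrating by parts twice against a compactly supported function. -/
theorem integral_mul_fderiv_fderiv {f φ : E → ℝ} (hf : ContDiff ℝ 2 f) (hφ : ContDiff ℝ 2 φ)
    (hc : HasCompactSupport φ) (v : E) (m : Measure E) [m.IsAddHaarMeasure] :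
    ∫ x, f x * fderiv ℝ (fun x => fderiv ℝ φ x v) x v ∂m =
      ∫ x, fderiv ℝ (fun x => fderiv ℝ f x v) x v * φ x ∂m := by
  have hf1 : ContDiff ℝ 1 (fun x => fderiv ℝ f x v) :=
    (hf.fderiv_right (m := 1) (by norm_num)).clm_apply contDiff_const
  have hφ1 : ContDiff ℝ 1 (fun x => fderiv ℝ φ x v) :=
    (hφ.fderiv_right (m := 1) (by norm_num)).clm_apply contDiff_const
  have hf2 : Continuous (fun x => fderiv ℝ (fun x => fderiv ℝ f x v) x v) :=
    (hf1.continuous_fderiv one_ne_zero).clm_apply continuous_const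
  have hφ2 : Continuous (fun x => fderiv ℝ (fun x => fderiv ℝ φ x v) x v) :=
    (hφ1.continuous_fderiv one_ne_zero).clm_apply continuous_const
  have hc1 : HasCompactSupport (fun x => fderiv ℝ φ x v) := hc.fderiv_apply ℝ v
  have hc2 : HasCompactSupport (fun x => fderiv ℝ (fun x => fderiv ℝ φ x v) x v) :=
    hc1.fderiv_apply ℝ v
  have I : ∀ {g h : E → ℝ}, Continuous g → Continuous h → HasCompactSupport h →
      Integrable (fun x => g x * h x) m := fun hg hh hs =>
    (hg.mul hh).integrable_of_hasCompactSupport hs.mul_left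
  rw [integral_mul_fderiv_eq_neg_fderiv_mul_of_integrable
    (I hf1.continuous hφ1.continuous hc1) (I hf.continuous hφ2 hc2)
    (I hf.continuous hφ1.continuous hc1)
    (fun x _ => (hf.differentiable two_ne_zero).differentiableAt)
    (fun x _ => (hφ1.differentiable one_ne_zero).differentiableAt),
    integral_mul_fderiv_eq_neg_fderiv_mul_of_integrable
    (I hf2 hφ.continuous hc) (I hf1.continuous hφ1.continuous hc1)
    (I hf1.continuous hφ.continuous hc)
    (fun x _ => (hf1.differentiable one_ne_zero).differentiableAt)
    (fun x _ => (hφ.differentiable two_ne_zero).differentiableAt), neg_neg]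

end Regularized

/-! ### Testing against minus the Laplacian of a bump -/

section

/-- Minus the Laplacian, computed in the standard orthonormal basis. -/
def negLaplacian (f : EuclideanSpace ℝ (Fin d) → ℝ) (x : EuclideanSpace ℝ (Fin d)) : ℝ :=
  - ∑ i, fderiv ℝ (fun x => fderiv ℝ f x (EuclideanSpace.basisFun (Fin d) ℝ i)) x
    (EuclideanSpace.basisFun (Fin d) ℝ i)

theorem continuous_fderiv_fderiv {f : 𝔼 → ℝ} (hf : ContDiff ℝ 2 f) (v : 𝔼) :
    Continuous (fun x => fderiv ℝ (fun x => fderiv ℝ f x v) x v) := by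
  have hf1 : ContDiff ℝ 1 (fun x => fderiv ℝ f x v) :=
    (hf.fderiv_right (m := 1) (by norm_num)).clm_apply contDiff_const
  exact (hf1.continuous_fderiv one_ne_zero).clm_apply continuous_const

theorem continuous_negLaplacian {f : 𝔼 → ℝ} (hf : ContDiff ℝ 2 f) :
    Continuous (negLaplacian f) :=
  (continuous_finsetSum _ fun _ _ => continuous_fderiv_fderiv hf _).neg

theorem support_negLaplacian_subset (f : 𝔼 → ℝ) :
    Function.support (negLaplacian f) ⊆ tsupport f := by
  intro x hx
  by_contra h
  refine hx ?_
  unfold negLaplacian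
  rw [Finset.sum_eq_zero, neg_zero]
  intro i _
  have h1 := (tsupport_fderiv_apply_subset ℝ (f := f) (EuclideanSpace.basisFun (Fin d) ℝ i))
  have h2 := (tsupport_fderiv_apply_subset ℝ
    (f := fun x => fderiv ℝ f x (EuclideanSpace.basisFun (Fin d) ℝ i))
    (EuclideanSpace.basisFun (Fin d) ℝ i))
  exact image_eq_zero_of_notMem_tsupport (x := x)
    (f := fun x => fderiv ℝ (fun x => fderiv ℝ f x (EuclideanSpace.basisFun (Fin d) ℝ i)) x
      (EuclideanSpace.basisFun (Fin d) ℝ i)) (fun h' => h (h1 (h2 h')))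

theorem hasCompactSupport_negLaplacian {f : 𝔼 → ℝ} (hc : HasCompactSupport f) :
    HasCompactSupport (negLaplacian f) :=
  hc.mono' (support_negLaplacian_subset f)

theorem integral_mul_negLaplacian {f φ : 𝔼 → ℝ} (hf : ContDiff ℝ 2 f) (hφ : ContDiff ℝ 2 φ)
    (hc : HasCompactSupport φ) :
    ∫ x, f x * negLaplacian φ x = ∫ x, negLaplacian f x * φ x := by
  unfold negLaplacian
  simp_rw [mul_neg, neg_mul, integral_neg, Finset.mul_sum, Finset.sum_mul]
  rw [integral_finsetSum, integral_finsetSum]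
  · simp_rw [integral_mul_fderiv_fderiv hf hφ hc _ volume]
  · exact fun i _ => ((continuous_fderiv_fderiv hf _).mul
      hφ.continuous).integrable_of_hasCompactSupport hc.mul_left
  · intro i _
    exact (hf.continuous.mul (continuous_fderiv_fderiv hφ _)).integrable_of_hasCompactSupport
      (((hc.fderiv_apply ℝ _).fderiv_apply ℝ _).mul_left)

/-- Affine functions are harmonic, so the test does not see the value and gradient subtracted from
the potential. -/
theorem integral_affine_mul_negLaplacian {φ : 𝔼 → ℝ} (hφ : ContDiff ℝ 2 φ)
    (hc : HasCompactSupport φ) (c : ℝ) (b : 𝔼) :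
    ∫ x, (c + inner ℝ b x) * negLaplacian φ x = 0 := by
  rw [integral_mul_negLaplacian (f := fun x => c + inner ℝ b x)
    (contDiff_const.add (innerSL ℝ b).contDiff) hφ hc]
  have : ∀ x, negLaplacian (fun x : 𝔼 => c + inner ℝ b x) x = 0 := by
    intro x
    have e : ∀ v, (fun x => fderiv ℝ (fun x : 𝔼 => c + inner ℝ b x) x v) =
        fun _ => inner ℝ b v := by
      intro v; funext x
      have : HasFDerivAt (fun x : 𝔼 => c + inner ℝ b x) (innerSL ℝ b) x :=
        ((innerSL ℝ b).hasFDerivAt).const_add c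
      rw [this.fderiv, innerSL_apply_apply]
    unfold negLaplacian
    simp_rw [e]
    simp
  simp [this]

theorem negLaplacian_regKernel {ε : ℝ} (hε : 0 < ε) (y x : 𝔼) :
    negLaplacian (regKernel ((2 - d) / 2) ε y) x =
      (d - 2) * d * ε ^ 2 * regKernel ((2 - (d : ℝ)) / 2 - 2) ε y x := by
  rw [negLaplacian, sum_fderiv_fderiv_regKernel _ hε y x (D := d) (by simp), neg_neg]

/-- The lower bound for the regularized potential of `-Δφ` near the origin. -/
def bumpConst (d : ℕ) : ℝ :=
  (d - 2) * d * (2 : ℝ) ^ ((2 - (d : ℝ)) / 2 - 2) *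
    volume.real (Metric.ball (0 : EuclideanSpace ℝ (Fin d)) 1)

theorem bumpConst_pos (hd : 3 ≤ d) : 0 < bumpConst d := by
  have : (3 : ℝ) ≤ d := by exact_mod_cast hd
  have h2 : (0 : ℝ) < d - 2 := by linarith
  have := volume_unit_ball_pos (d := d)
  unfold bumpConst
  positivity

/-- After integrating by parts, `-Δ` of the regularized kernel is positive and puts mass at least
`bumpConst d` in `B(y,ε)`, uniformly in `ε`. For `‖y‖ < 1` and `ε ≤ 1` this ball lies where `φ = 1`.
-/
theorem regKernel_mul_negLaplacian_bounds (hd : 3 ≤ d) (φ : ContDiffBump (0 : 𝔼))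
    (hφ : φ.rIn = 2) {ε : ℝ} (hε : 0 < ε) (hε1 : ε ≤ 1) (y : 𝔼) :
    (Metric.ball (0 : 𝔼) 1).indicator (fun _ => bumpConst d) y ≤
      ∫ x, regKernel ((2 - d) / 2) ε y x * negLaplacian φ x := by
  have hd3 : (3 : ℝ) ≤ d := by exact_mod_cast hd
  have hd2 : (0 : ℝ) < d - 2 := by linarith
  rw [integral_mul_negLaplacian (contDiff_regKernel hε _ y) φ.contDiff φ.hasCompactSupport]
  simp_rw [negLaplacian_regKernel hε]
  set q : ℝ := (2 - (d : ℝ)) / 2 - 2 with hq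
  have hnn : ∀ x, 0 ≤ (d - 2) * d * ε ^ 2 * regKernel q ε y x * φ x := fun x => by
    have := regKernel_pos hε q y x
    have := φ.nonneg' x
    positivity
  refine indicator_apply_le' (fun hy => ?_) fun _ => integral_nonneg hnn
  have hcont : Continuous (fun x => (d - 2) * d * ε ^ 2 * regKernel q ε y x * φ x) :=
    (continuous_const.mul (contDiff_regKernel hε q y).continuous).mul φ.continuous
  have hint : Integrable (fun x => (d - 2) * d * ε ^ 2 * regKernel q ε y x * φ x) :=
    hcont.integrable_of_hasCompactSupport φ.hasCompactSupport.mul_left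
  have hvol : volume.real (Metric.ball y ε) =
      volume.real (Metric.ball (0 : 𝔼) 1) * ε ^ d := by
    rw [measureReal_def, volume_ball_eq hd y hε.le, ENNReal.toReal_ofReal (by positivity)]
  -- Scale invariance: `2 + 2q + d = 0`.
  have hpow : ε ^ 2 * (2 * ε ^ 2) ^ q * ε ^ d = 2 ^ q := by
    rw [Real.mul_rpow (by norm_num) (by positivity), ← Real.rpow_natCast ε 2,
      ← Real.rpow_natCast ε d, ← Real.rpow_mul hε.le]
    have : ε ^ ((2 : ℕ) : ℝ) * (2 ^ q * ε ^ (((2 : ℕ) : ℝ) * q)) * ε ^ (d : ℝ) =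
      2 ^ q * (ε ^ ((2 : ℕ) : ℝ) * ε ^ (((2 : ℕ) : ℝ) * q) * ε ^ (d : ℝ)) := by ring
    rw [this, ← Real.rpow_add hε, ← Real.rpow_add hε,
      show ((2 : ℕ) : ℝ) + ((2 : ℕ) : ℝ) * q + d = 0 by rw [hq]; push_cast; ring,
      Real.rpow_zero, mul_one]
  calc bumpConst d
      = ∫ x in Metric.ball y ε, (d - 2) * d * ε ^ 2 * (2 * ε ^ 2) ^ q := by
        rw [setIntegral_const, hvol, smul_eq_mul, bumpConst, ← hpow]
        ring
    _ ≤ ∫ x in Metric.ball y ε, (d - 2) * d * ε ^ 2 * regKernel q ε y x * φ x := by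
        refine setIntegral_mono_on (integrableOn_const measure_ball_lt_top.ne) hint.integrableOn
          measurableSet_ball fun x hx => ?_
        rw [Metric.mem_ball, dist_eq_norm] at hx
        rw [Metric.mem_ball, dist_zero_right] at hy
        have h1 : φ x = 1 := by
          refine φ.one_of_mem_closedBall ?_
          rw [hφ, mem_closedBall_zero_iff]
          calc ‖x‖ = ‖(x - y) + y‖ := by simp
            _ ≤ ‖x - y‖ + ‖y‖ := norm_add_le _ _
            _ ≤ 2 := by linarith
        rw [h1, mul_one]
        refine mul_le_mul_of_nonneg_left ?_ (by positivity)
        unfold regKernel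
        refine Real.rpow_le_rpow_of_nonpos (regKernel_base_pos hε y x) ?_ (by rw [hq]; linarith)
        have : ‖x - y‖ ^ 2 ≤ ε ^ 2 := by gcongr
        linarith
    _ ≤ _ := setIntegral_le_integral hint (Eventually.of_forall hnn)

end

/-! ### Mass bounded by the mean distance of the potential to affine functions -/

section

theorem exists_lintegral_ball_kernel_le (hd : 3 ≤ d) :
    ∃ C : ℝ, 0 < C ∧ ∀ (x z : 𝔼) (r : ℝ), 0 < r →
      ∫⁻ y in Metric.ball z r, (‖x - y‖ₑ ^ (d - 2))⁻¹ ≤ ENNReal.ofReal (C * r ^ 2) := by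
  obtain ⟨C, hC, h⟩ := exists_lintegral_kernel_le hd
  set v := volume.real (Metric.ball (0 : 𝔼) 1) with hv
  have hvp : 0 < v := volume_unit_ball_pos
  refine ⟨C * (v + 1) ^ 2, by positivity, fun x z r hr => ?_⟩
  refine (h (Metric.ball z r) ((v + 1) * r) (by positivity) (volume_ball_le_pow hd z hr)
    x).trans (le_of_eq ?_)
  congr 1; ring

/-- By Tonelli, the kernel is integrated over the ball first, with a bound uniform in `y`. -/
theorem exists_lintegral_ball_rieszPotential_le (hd : 3 ≤ d) :
    ∃ C : ℝ, 0 < C ∧ ∀ (ν : Measure 𝔼), IsFiniteMeasure ν → ∀ (z : 𝔼) (r : ℝ), 0 < r →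
      ∫⁻ x in Metric.ball z r, rieszPotential ν x ≤ ENNReal.ofReal (C * r ^ 2) * ν univ := by
  obtain ⟨C, hC, h⟩ := exists_lintegral_ball_kernel_le hd
  refine ⟨C, hC, fun ν hν z r hr => ?_⟩
  simp only [rieszPotential]
  rw [lintegral_lintegral_swap (f := fun x y : 𝔼 => (‖x - y‖ₑ ^ (d - 2))⁻¹)
    (by fun_prop : Measurable fun p : 𝔼 × 𝔼 => (‖p.1 - p.2‖ₑ ^ (d - 2))⁻¹).aemeasurable,
    ← lintegral_const]
  refine lintegral_mono fun y => ?_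
  simp_rw [enorm_sub_rev _ y]
  exact h y z r hr

/-- The potential regularized by replacing `‖x - y‖` with `(‖x - y‖² + ε²) ^ (1 / 2)`. -/
def regPotential (ν : Measure (EuclideanSpace ℝ (Fin d))) (ε : ℝ)
    (x : EuclideanSpace ℝ (Fin d)) : ℝ :=
  ∫ y, regKernel ((2 - (d : ℝ)) / 2) ε y x ∂ν

theorem continuous_regKernel_uncurry {ε : ℝ} (hε : 0 < ε) (p : ℝ) :
    Continuous (fun z : 𝔼 × 𝔼 => regKernel p ε z.2 z.1) := by
  unfold regKernel
  refine Continuous.rpow_const (by fun_prop) fun z => Or.inl ?_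
  exact (regKernel_base_pos hε _ _).ne'

theorem regKernel_le (hd : 3 ≤ d) {ε : ℝ} (hε : 0 < ε) (y x : 𝔼) :
    regKernel ((2 - (d : ℝ)) / 2) ε y x ≤ (ε ^ 2) ^ ((2 - (d : ℝ)) / 2) := by
  have hd3 : (3 : ℝ) ≤ d := by exact_mod_cast hd
  exact Real.rpow_le_rpow_of_nonpos (by positivity) (by linarith [sq_nonneg ‖x - y‖])
    (by linarith)

theorem sq_rpow_eq_inv_pow (hd : 3 ≤ d) {t : ℝ} (ht : 0 ≤ t) :
    (t ^ 2) ^ ((2 - (d : ℝ)) / 2) = (t ^ (d - 2))⁻¹ := by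
  rw [← Real.rpow_natCast t 2, ← Real.rpow_mul ht, ← Real.rpow_natCast, ← Real.rpow_neg ht]
  congr 1
  rw [Nat.cast_sub (by omega)]
  push_cast
  ring

theorem regKernel_le_inv_pow (hd : 3 ≤ d) (ε : ℝ) {y x : 𝔼} (hxy : y ≠ x) :
    regKernel ((2 - (d : ℝ)) / 2) ε y x ≤ (‖x - y‖ ^ (d - 2))⁻¹ := by
  have hd3 : (3 : ℝ) ≤ d := by exact_mod_cast hd
  have : 0 < ‖x - y‖ := norm_pos_iff.2 (sub_ne_zero.2 hxy.symm)
  rw [← sq_rpow_eq_inv_pow hd this.le]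
  exact Real.rpow_le_rpow_of_nonpos (by positivity) (by linarith [sq_nonneg ε]) (by linarith)

theorem measure_singleton_eq_zero (hd : 3 ≤ d) {ν : Measure 𝔼} {x : 𝔼}
    (hx : rieszPotential ν x ≠ ∞) : ν {x} = 0 := by
  by_contra h
  refine hx (top_unique ?_)
  calc ∞ = ∫⁻ y in {x}, (‖x - y‖ₑ ^ (d - 2))⁻¹ ∂ν := by
        rw [lintegral_singleton, sub_self, enorm_zero, zero_pow (by omega), ENNReal.inv_zero,
          ENNReal.top_mul h]
    _ ≤ _ := setLIntegral_le_lintegral _ _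

/-- On the diagonal the real kernel is 0 by the convention for inverses while the extended one is
`∞`; finiteness of the potential rules out an atom at `x`, so the difference is invisible. -/
theorem rieszPotential_real (hd : 3 ≤ d) {ν : Measure 𝔼} {x : 𝔼}
    (hx : rieszPotential ν x ≠ ∞) :
    Integrable (fun y => (‖x - y‖ ^ (d - 2))⁻¹) ν ∧
      (rieszPotential ν x).toReal = ∫ y, (‖x - y‖ ^ (d - 2))⁻¹ ∂ν := by
  have h0 : ∀ᵐ y ∂ν, y ≠ x := by
    rw [ae_iff]; simpa using measure_singleton_eq_zero hd hx
  have e : ∫⁻ y, ENNReal.ofReal ((‖x - y‖ ^ (d - 2))⁻¹) ∂ν = rieszPotential ν x := by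
    refine lintegral_congr_ae ?_
    filter_upwards [h0] with y hy
    have hpos : 0 < ‖x - y‖ := norm_pos_iff.2 (sub_ne_zero.2 hy.symm)
    rw [ENNReal.ofReal_inv_of_pos (by positivity), ENNReal.ofReal_pow hpos.le, ofReal_norm]
  have hm : AEStronglyMeasurable (fun y => (‖x - y‖ ^ (d - 2))⁻¹) ν :=
    (by fun_prop : Measurable fun y => (‖x - y‖ ^ (d - 2))⁻¹).aestronglyMeasurable
  have hnn : 0 ≤ᵐ[ν] fun y => (‖x - y‖ ^ (d - 2))⁻¹ := Eventually.of_forall fun y => by positivity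
  refine ⟨⟨hm, ?_⟩, ?_⟩
  · rw [hasFiniteIntegral_iff_ofReal hnn, e]; exact lt_top_iff_ne_top.2 hx
  · rw [integral_eq_lintegral_of_nonneg_ae hnn hm, e]

theorem integrable_regKernel (hd : 3 ≤ d) (ν : Measure 𝔼) [IsFiniteMeasure ν] {ε : ℝ}
    (hε : 0 < ε) (x : 𝔼) : Integrable (fun y => regKernel ((2 - (d : ℝ)) / 2) ε y x) ν := by
  refine Integrable.of_bound (C := (ε ^ 2) ^ ((2 - (d : ℝ)) / 2)) ?_ ?_
  · exact ((continuous_regKernel_uncurry hε _).comp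
      (continuous_const.prodMk continuous_id)).aestronglyMeasurable
  · refine Eventually.of_forall fun y => ?_
    rw [Real.norm_of_nonneg (regKernel_pos hε _ _ _).le]
    exact regKernel_le hd hε y x

theorem regPotential_le (hd : 3 ≤ d) (ν : Measure 𝔼) [IsFiniteMeasure ν] {ε : ℝ}
    (hε : 0 < ε) {x : 𝔼} (hx : rieszPotential ν x ≠ ∞) :
    regPotential ν ε x ≤ (rieszPotential ν x).toReal := by
  obtain ⟨h1, h2⟩ := rieszPotential_real hd hx
  rw [h2, regPotential]
  have h0 : ∀ᵐ y ∂ν, y ≠ x := by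
    rw [ae_iff]; simpa using measure_singleton_eq_zero hd hx
  refine integral_mono_ae (integrable_regKernel hd ν hε x) h1 ?_
  filter_upwards [h0] with y hy using regKernel_le_inv_pow hd ε hy

theorem tendsto_regPotential (hd : 3 ≤ d) (ν : Measure 𝔼) [IsFiniteMeasure ν] {x : 𝔼}
    (hx : rieszPotential ν x ≠ ∞) {e : ℕ → ℝ} (he0 : ∀ k, 0 < e k)
    (he : Tendsto e atTop (𝓝 0)) :
    Tendsto (fun k => regPotential ν (e k) x) atTop (𝓝 (rieszPotential ν x).toReal) := by
  obtain ⟨h1, h2⟩ := rieszPotential_real hd hx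
  have h0 : ∀ᵐ y ∂ν, y ≠ x := by
    rw [ae_iff]; simpa using measure_singleton_eq_zero hd hx
  rw [h2]
  refine tendsto_integral_of_dominated_convergence _
    (fun k => (integrable_regKernel hd ν (he0 k) x).aestronglyMeasurable) h1 (fun k => ?_) ?_
  · filter_upwards [h0] with y hy
    rw [Real.norm_of_nonneg (regKernel_pos (he0 k) _ _ _).le]
    exact regKernel_le_inv_pow hd _ hy
  · filter_upwards [h0] with y hy
    have hpos : 0 < ‖x - y‖ := norm_pos_iff.2 (sub_ne_zero.2 hy.symm)
    rw [← sq_rpow_eq_inv_pow hd hpos.le]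
    unfold regKernel
    refine Tendsto.rpow_const ?_ (Or.inl (by positivity))
    simpa using (he.pow 2).const_add (‖x - y‖ ^ 2)

theorem bumpConst_mul_le_integral (hd : 3 ≤ d) (φ : ContDiffBump (0 : 𝔼)) (hφ : φ.rIn = 2)
    (ν : Measure 𝔼) [IsFiniteMeasure ν] {ε : ℝ} (hε : 0 < ε) (hε1 : ε ≤ 1) :
    bumpConst d * ν.real (Metric.ball 0 1) ≤
      ∫ x, regPotential ν ε x * negLaplacian φ x := by
  have hψc : Continuous (negLaplacian φ) := continuous_negLaplacian φ.contDiff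
  have hψs : HasCompactSupport (negLaplacian φ) :=
    hasCompactSupport_negLaplacian φ.hasCompactSupport
  have hψi : Integrable (negLaplacian φ) := hψc.integrable_of_hasCompactSupport hψs
  have hprod : Integrable (fun z : 𝔼 × 𝔼 =>
      regKernel ((2 - (d : ℝ)) / 2) ε z.1 z.2 * negLaplacian φ z.2) (ν.prod volume) := by
    refine (hψi.comp_snd ν).bdd_mul (c := (ε ^ 2) ^ ((2 - (d : ℝ)) / 2)) ?_ ?_
    · exact ((continuous_regKernel_uncurry hε _).comp continuous_swap).aestronglyMeasurable
    · refine Eventually.of_forall fun z => ?_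
      rw [Real.norm_of_nonneg (regKernel_pos hε _ _ _).le]
      exact regKernel_le hd hε _ _
  calc bumpConst d * ν.real (Metric.ball 0 1)
      = ∫ y, (Metric.ball (0 : 𝔼) 1).indicator (fun _ => bumpConst d) y ∂ν := by
        rw [integral_indicator measurableSet_ball, setIntegral_const, smul_eq_mul, mul_comm]
    _ ≤ ∫ y, (∫ x, regKernel ((2 - (d : ℝ)) / 2) ε y x * negLaplacian φ x) ∂ν := by
        refine integral_mono ((integrable_const _).indicator measurableSet_ball)
          hprod.integral_prod_left fun y => ?_
        exact regKernel_mul_negLaplacian_bounds hd φ hφ hε hε1 y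
    _ = ∫ x, ∫ y, regKernel ((2 - (d : ℝ)) / 2) ε y x * negLaplacian φ x ∂ν :=
        integral_integral_swap
          (f := fun y x => regKernel ((2 - (d : ℝ)) / 2) ε y x * negLaplacian φ x) hprod
    _ = _ := by simp_rw [integral_mul_const]; rfl

/-- If the potential is close to an affine function in mean, then the measure is small. -/
theorem exists_measure_unit_ball_le (hd : 3 ≤ d) :
    ∃ C : ℝ, 0 < C ∧ ∀ (ν : Measure 𝔼), IsFiniteMeasure ν → ∀ (c : ℝ) (b : 𝔼),
      ν (Metric.ball 0 1) ≤ ENNReal.ofReal C * ∫⁻ x in Metric.ball (0 : 𝔼) 3,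
        ENNReal.ofReal |(rieszPotential ν x).toReal - (c + inner ℝ b x)| := by
  -- The inner radius 2 contains every `B(y,ε)` with `‖y‖ < 1`, `ε ≤ 1`; the outer radius keeps the
  -- support of `-Δφ` inside `B(0,3)`.
  set φ : ContDiffBump (0 : 𝔼) := ⟨2, 5 / 2, by norm_num, by norm_num⟩ with hφ
  set ψ := negLaplacian φ with hψ
  have hψc : Continuous ψ := continuous_negLaplacian φ.contDiff
  have hψs : HasCompactSupport ψ := hasCompactSupport_negLaplacian φ.hasCompactSupport
  obtain ⟨M, hM⟩ := hψc.bounded_above_of_compact_support hψs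
  have hM0 : 0 ≤ M := (norm_nonneg _).trans (hM 0)
  have hψ0 : ∀ x, x ∉ Metric.ball (0 : 𝔼) 3 → ψ x = 0 := by
    intro x hx
    by_contra h
    have := support_negLaplacian_subset (φ : 𝔼 → ℝ) h
    rw [φ.tsupport_eq, mem_closedBall_zero_iff] at this
    refine hx (mem_ball_zero_iff.2 (this.trans_lt ?_))
    rw [hφ]; norm_num
  obtain ⟨C₁, hC₁, hpot⟩ := exists_lintegral_ball_rieszPotential_le hd
  have hbc := bumpConst_pos hd
  refine ⟨(M + 1) / bumpConst d, by positivity, fun ν hν c b => ?_⟩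
  set U : 𝔼 → ℝ := fun x => (rieszPotential ν x).toReal with hU
  have hmeas := measurable_rieszPotential ν
  have hfin : ∫⁻ x in Metric.ball (0 : 𝔼) 3, rieszPotential ν x ≠ ∞ :=
    ((hpot ν hν 0 3 (by norm_num)).trans_lt
      (ENNReal.mul_lt_top ENNReal.ofReal_lt_top (measure_lt_top _ _))).ne
  have hae : ∀ᵐ x, x ∈ Metric.ball (0 : 𝔼) 3 → rieszPotential ν x ≠ ∞ := by
    rw [← ae_restrict_iff' measurableSet_ball]
    filter_upwards [ae_lt_top hmeas hfin] with x hx using hx.ne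
  have hUi : IntegrableOn U (Metric.ball 0 3) :=
    integrable_toReal_of_lintegral_ne_top hmeas.aemeasurable hfin
  have hUψ : Integrable (fun x => U x * ψ x) := by
    rw [← integrableOn_iff_integrable_of_support_subset (s := Metric.ball (0 : 𝔼) 3)]
    · exact Integrable.mul_bdd (c := M) hUi hψc.aestronglyMeasurable.restrict
        (Eventually.of_forall hM)
    · intro x hx
      by_contra h
      exact hx (by simp [hψ0 x h])
  -- The mass bound is available for regularized potentials only; these lie below the true
  -- potential, so dominated convergence removes the regularization.
  have hlim : Tendsto (fun k : ℕ => ∫ x, regPotential ν (1 / ((k : ℝ) + 1)) x * ψ x) atTop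
      (𝓝 (∫ x, U x * ψ x)) := by
    refine tendsto_integral_of_dominated_convergence (fun x => ‖U x * ψ x‖) (fun k => ?_)
      hUψ.norm (fun k => ?_) ?_
    · refine AEStronglyMeasurable.mul ?_ hψc.aestronglyMeasurable
      have := (continuous_regKernel_uncurry (d := d) (Nat.one_div_pos_of_nat (α := ℝ) (n := k))
        ((2 - (d : ℝ)) / 2)).stronglyMeasurable.integral_prod_right' (ν := ν)
      exact this.aestronglyMeasurable
    · filter_upwards [hae] with x hx
      by_cases h : x ∈ Metric.ball (0 : 𝔼) 3
      · rw [norm_mul, norm_mul]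
        gcongr
        have h1 := regPotential_le hd ν (Nat.one_div_pos_of_nat (α := ℝ) (n := k)) (hx h)
        have h2 : 0 ≤ regPotential ν (1 / ((k : ℝ) + 1)) x :=
          integral_nonneg fun y => (regKernel_pos Nat.one_div_pos_of_nat _ _ _).le
        rw [Real.norm_of_nonneg h2, Real.norm_of_nonneg ENNReal.toReal_nonneg]
        exact h1
      · simp [hψ0 x h]
    · filter_upwards [hae] with x hx
      by_cases h : x ∈ Metric.ball (0 : 𝔼) 3
      · exact (tendsto_regPotential hd ν (hx h) (fun k => Nat.one_div_pos_of_nat)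
          tendsto_one_div_add_atTop_nhds_zero_nat).mul_const _
      · simp [hψ0 x h]
  have hmain : bumpConst d * ν.real (Metric.ball 0 1) ≤ ∫ x, U x * ψ x := by
    refine ge_of_tendsto' hlim fun k => ?_
    refine bumpConst_mul_le_integral hd φ rfl ν Nat.one_div_pos_of_nat ?_
    rw [div_le_one (by positivity)]
    linarith [Nat.cast_nonneg (α := ℝ) k]
  have hℓi : Integrable (fun x => (c + inner ℝ b x) * ψ x) :=
    ((by fun_prop : Continuous fun x : 𝔼 => c + inner ℝ b x).mul
      hψc).integrable_of_hasCompactSupport hψs.mul_left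
  have hℓ : ∫ x, (c + inner ℝ b x) * ψ x = 0 :=
    integral_affine_mul_negLaplacian φ.contDiff φ.hasCompactSupport c b
  have e : ∫ x, U x * ψ x = ∫ x, (U x - (c + inner ℝ b x)) * ψ x := by
    simp_rw [sub_mul]
    rw [integral_sub hUψ hℓi, hℓ, sub_zero]
  have h1 : ENNReal.ofReal (bumpConst d * ν.real (Metric.ball 0 1)) ≤
      ENNReal.ofReal (M + 1) * ∫⁻ x in Metric.ball (0 : 𝔼) 3,
        ENNReal.ofReal |U x - (c + inner ℝ b x)| := by
    calc ENNReal.ofReal (bumpConst d * ν.real (Metric.ball 0 1))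
        ≤ ENNReal.ofReal ‖∫ x, (U x - (c + inner ℝ b x)) * ψ x‖ :=
          ENNReal.ofReal_le_ofReal ((hmain.trans e.le).trans (Real.le_norm_self _))
      _ ≤ ∫⁻ x, ‖(U x - (c + inner ℝ b x)) * ψ x‖ₑ := by
          rw [ofReal_norm]; exact enorm_integral_le_lintegral_enorm _
      _ ≤ ∫⁻ x, (Metric.ball (0 : 𝔼) 3).indicator
            (fun x => ENNReal.ofReal (M + 1) * ENNReal.ofReal |U x - (c + inner ℝ b x)|) x := by
          refine lintegral_mono fun x => ?_
          by_cases h : x ∈ Metric.ball (0 : 𝔼) 3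
          · rw [indicator_of_mem h, enorm_mul, mul_comm, ← Real.norm_eq_abs, ofReal_norm]
            gcongr
            rw [← ofReal_norm]
            exact ENNReal.ofReal_le_ofReal ((hM x).trans (by linarith))
          · simp [hψ0 x h]
      _ = _ := by
          rw [lintegral_indicator measurableSet_ball,
            lintegral_const_mul' _ _ ENNReal.ofReal_ne_top]
  rw [ENNReal.ofReal_mul hbc.le, ofReal_measureReal, mul_comm,
    ← ENNReal.le_div_iff_mul_le (by simp [hbc]) (by simp)] at h1
  refine h1.trans (le_of_eq ?_)
  rw [ENNReal.ofReal_div_of_pos hbc, div_eq_mul_inv, div_eq_mul_inv]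
  ring

end

/-! ### Scaling, and passage from capacity to Lebesgue measure -/

section

theorem lintegral_comp_add_smul (G : 𝔼 → ℝ≥0∞) (hG : Measurable G) (a : 𝔼) {r : ℝ} (hr : 0 < r) :
    ∫⁻ z, G (a + r • z) = ENNReal.ofReal ((r ^ d)⁻¹) * ∫⁻ x, G x := by
  have h1 : ∫⁻ z, G (a + r • z) = ∫⁻ w, G (a + w) ∂(Measure.map (fun z : 𝔼 => r • z) volume) := by
    rw [lintegral_map (by fun_prop) (by fun_prop)]
  rw [h1, Measure.map_addHaar_smul volume hr.ne', lintegral_smul_measure,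
    finrank_euclideanSpace_fin, abs_of_pos (by positivity), lintegral_add_left_eq_self G a,
    smul_eq_mul]

theorem rieszPotential_map_dilation (μ : Measure 𝔼) (a z : 𝔼) {r : ℝ} (hr : 0 < r) :
    rieszPotential (μ.map fun y => r⁻¹ • (y - a)) z =
      ENNReal.ofReal (r ^ (d - 2)) * rieszPotential μ (a + r • z) := by
  unfold rieszPotential
  rw [lintegral_map (by fun_prop) (by fun_prop),
    ← lintegral_const_mul' _ _ ENNReal.ofReal_ne_top]
  refine lintegral_congr fun y => ?_
  have e : z - r⁻¹ • (y - a) = r⁻¹ • (a + r • z - y) := by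
    rw [smul_sub, smul_sub, smul_add, smul_smul, inv_mul_cancel₀ hr.ne', one_smul]; abel
  have e2 : ‖r⁻¹‖ₑ = (ENNReal.ofReal r)⁻¹ := by
    rw [← ofReal_norm, Real.norm_of_nonneg (by positivity), ENNReal.ofReal_inv_of_pos hr]
  have h0 : ENNReal.ofReal r ≠ 0 := by simpa using hr
  have e3 : ((ENNReal.ofReal r)⁻¹ ^ (d - 2))⁻¹ = ENNReal.ofReal r ^ (d - 2) := by
    rw [ENNReal.inv_pow, inv_inv]
  rw [e, enorm_smul, e2, mul_pow, ENNReal.mul_inv (by simp) (by simp [h0]), e3,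
    ENNReal.ofReal_pow hr.le]

theorem measurable_remainder (μ : Measure 𝔼) [SFinite μ] (a : 𝔼) (A : Fin d → ℝ) :
    Measurable (remainder μ a A) := by
  have := measurable_rieszPotential μ
  unfold remainder
  fun_prop

/-- Dilate to the unit ball: the homogeneity of the kernel gives `r^(d-2)` and the change of
variables `r^(-d)`. -/
theorem exists_measure_ball_le (hd : 3 ≤ d) :
    ∃ C : ℝ, 0 < C ∧ ∀ (μ : Measure 𝔼), IsFiniteMeasure μ → ∀ (a : 𝔼) (A : Fin d → ℝ) (r : ℝ),
      0 < r → μ (Metric.ball a r) ≤ ENNReal.ofReal (C * (r ^ 2)⁻¹) *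
        ∫⁻ x in Metric.ball a (3 * r), ENNReal.ofReal |remainder μ a A x| := by
  obtain ⟨C, hC, h⟩ := exists_measure_unit_ball_le hd
  refine ⟨C, hC, fun μ hμ a A r hr => ?_⟩
  set f : 𝔼 → 𝔼 := fun y => r⁻¹ • (y - a) with hf
  have hfm : Measurable f := by fun_prop
  have h1 := h (μ.map f) inferInstance (r ^ (d - 2) * (rieszPotential μ a).toReal)
    ((r ^ (d - 2) * r) • (WithLp.toLp 2 A : 𝔼))
  have hpre : f ⁻¹' Metric.ball 0 1 = Metric.ball a r := by
    ext y
    rw [mem_preimage, mem_ball_zero_iff, hf, Metric.mem_ball, dist_eq_norm, norm_smul,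
      Real.norm_of_nonneg (by positivity), inv_mul_lt_iff₀ hr, mul_one]
  rw [Measure.map_apply hfm measurableSet_ball, hpre] at h1
  refine h1.trans ?_
  set G : 𝔼 → ℝ≥0∞ := (Metric.ball a (3 * r)).indicator
    (fun x => ENNReal.ofReal |remainder μ a A x|) with hG
  have hGm : Measurable G := by
    have := measurable_remainder μ a A
    exact Measurable.indicator (ENNReal.measurable_ofReal.comp this.abs) measurableSet_ball
  have e : ∫⁻ x in Metric.ball (0 : 𝔼) 3,
      ENNReal.ofReal |(rieszPotential (μ.map f) x).toReal -
        (r ^ (d - 2) * (rieszPotential μ a).toReal +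
          inner ℝ ((r ^ (d - 2) * r) • (WithLp.toLp 2 A : 𝔼)) x)| =
      ENNReal.ofReal (r ^ (d - 2)) * ∫⁻ z, G (a + r • z) := by
    rw [← lintegral_const_mul' _ _ ENNReal.ofReal_ne_top, ← lintegral_indicator measurableSet_ball]
    refine lintegral_congr fun z => ?_
    have hmem : a + r • z ∈ Metric.ball a (3 * r) ↔ z ∈ Metric.ball (0 : 𝔼) 3 := by
      rw [Metric.mem_ball, dist_eq_norm, add_sub_cancel_left, norm_smul,
        Real.norm_of_nonneg hr.le, mem_ball_zero_iff, mul_comm, mul_lt_mul_iff_left₀ hr]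
    by_cases hz : z ∈ Metric.ball (0 : 𝔼) 3
    · rw [indicator_of_mem hz, hG, indicator_of_mem (hmem.2 hz), ← ENNReal.ofReal_mul (by positivity)]
      congr 1
      rw [rieszPotential_map_dilation μ a z hr, ENNReal.toReal_mul,
        ENNReal.toReal_ofReal (by positivity), remainder, sum_mul_sub_eq_inner,
        add_sub_cancel_left, real_inner_smul_left, inner_smul_right]
      have hrp : 0 < r ^ (d - 2) := by positivity
      rw [← abs_of_pos hrp, ← abs_mul, abs_of_pos hrp]
      congr 1
      ring
    · rw [indicator_of_notMem hz, hG, indicator_of_notMem (fun h' => hz (hmem.1 h')), mul_zero]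
  rw [e, lintegral_comp_add_smul G hGm a hr, hG, lintegral_indicator measurableSet_ball,
    ← mul_assoc, ← mul_assoc, ← ENNReal.ofReal_mul hC.le, ← ENNReal.ofReal_mul (by positivity)]
  refine le_of_eq ?_
  congr 2
  have : r ^ d = r ^ (d - 2) * r ^ 2 := by rw [← pow_add]; congr 1; omega
  rw [this]
  field_simp

/-- Weak type control of the capacity of superlevel sets gives integral control. -/
theorem exists_lintegral_le_of_newtonianCap_le (hd : 3 ≤ d) :
    ∃ C : ℝ, 0 < C ∧ ∀ (f : 𝔼 → ℝ), Measurable f → (∀ x, 0 ≤ f x) →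
      ∀ (a : 𝔼) (r ε : ℝ), 0 < r → 0 < ε →
      (∀ t : ℝ, 0 < t → ENNReal.ofReal t * newtonianCap {x | x ∈ Metric.ball a r ∧ t < f x} ≤
        ENNReal.ofReal (ε * r ^ (d - 2))) →
      ∫⁻ x in Metric.ball a r, ENNReal.ofReal (f x) ≤ ENNReal.ofReal (C * ε * r ^ d) := by
  obtain ⟨C₁, hC₁, -, hiso⟩ := exists_volume_le_newtonianCap hd
  set v := volume.real (Metric.ball (0 : 𝔼) 1) with hv
  have hvp : 0 < v := volume_unit_ball_pos
  have hd3 : (3 : ℝ) ≤ d := by exact_mod_cast hd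
  set n : ℝ := (d : ℝ) - 2 with hn
  have hn0 : 0 < n := by rw [hn]; linarith
  have hnd : ((d - 2 : ℕ) : ℝ) = n := by rw [hn, Nat.cast_sub (by omega)]; norm_num
  -- The isocapacitary exponent: capacity bounds of order `1/t` become volume bounds of order
  -- `t^(-p)`.
  set p : ℝ := d / n with hp
  have hp1 : 1 < p := by rw [hp, one_lt_div hn0]; linarith
  have hp2 : 0 < p - 1 := by linarith
  refine ⟨v + C₁ ^ p / (p - 1), by positivity, fun f hf hf0 a r ε hr hε hcap => ?_⟩
  have hEm : ∀ t, MeasurableSet {x | x ∈ Metric.ball a r ∧ t < f x} := fun t =>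
    measurableSet_ball.inter (measurableSet_lt measurable_const hf)
  have hE1 : ∀ t, volume {x | x ∈ Metric.ball a r ∧ t < f x} ≤ ENNReal.ofReal (v * r ^ d) := by
    intro t
    rw [hv, ← volume_ball_eq hd a hr.le]
    exact measure_mono fun x hx => hx.1
  have hE2 : ∀ t, 0 < t → volume {x | x ∈ Metric.ball a r ∧ t < f x} ≤
      ENNReal.ofReal ((C₁ * ε) ^ p * r ^ d * t ^ (-p)) := by
    intro t ht
    set S := {x | x ∈ Metric.ball a r ∧ t < f x} with hS
    have hfin : volume S ≠ ∞ := ne_top_of_le_ne_top ENNReal.ofReal_ne_top (hE1 t)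
    set V := volume.real S with hV
    have hVS : volume S = ENNReal.ofReal V := (ofReal_measureReal hfin).symm
    rcases (measureReal_nonneg : 0 ≤ V).eq_or_lt with h0 | h0
    · rw [hVS, hV, ← h0]; simp
    -- Radius with `R ^ d = V`, for which the isocapacitary inequality reads `R^(d-2) ≤ C₁ Cap(S)`.
    set R := V ^ ((d : ℝ)⁻¹) with hR
    have hR0 : 0 < R := Real.rpow_pos_of_pos h0 _
    have hRd : R ^ d = V := Real.rpow_inv_natCast_pow h0.le (by omega)
    have h1 := hiso S R hR0 (hEm t) (by rw [hRd, hVS])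
    have h2 : ENNReal.ofReal (t * V) ≤ ENNReal.ofReal (C₁ * R ^ 2 * (ε * r ^ (d - 2))) := by
      rw [ENNReal.ofReal_mul ht.le, ← hVS, ENNReal.ofReal_mul (by positivity)]
      calc ENNReal.ofReal t * volume S
          ≤ ENNReal.ofReal t * (ENNReal.ofReal (C₁ * R ^ 2) * newtonianCap S) := by gcongr
        _ = ENNReal.ofReal (C₁ * R ^ 2) * (ENNReal.ofReal t * newtonianCap S) := by ring
        _ ≤ _ := by gcongr; exact hcap t ht
    rw [ENNReal.ofReal_le_ofReal_iff (by positivity), ← hRd,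
      show R ^ d = R ^ (d - 2) * R ^ 2 by rw [← pow_add]; congr 1; omega] at h2
    have h3 : R ^ (d - 2) ≤ C₁ * ε * t⁻¹ * r ^ (d - 2) := by
      have : 0 < R ^ 2 := by positivity
      have h4 : t * R ^ (d - 2) ≤ C₁ * ε * r ^ (d - 2) := by nlinarith
      calc R ^ (d - 2) = t⁻¹ * (t * R ^ (d - 2)) := by field_simp
        _ ≤ t⁻¹ * (C₁ * ε * r ^ (d - 2)) := by gcongr
        _ = _ := by ring
    have hpw : ∀ x : ℝ, 0 ≤ x → (x ^ (d - 2)) ^ p = x ^ d := by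
      intro x hx
      rw [← Real.rpow_natCast x (d - 2), ← Real.rpow_mul hx, hnd, hp, mul_div_cancel₀ _ hn0.ne',
        Real.rpow_natCast]
    rw [hVS]
    apply ENNReal.ofReal_le_ofReal
    calc V = (R ^ (d - 2)) ^ p := by rw [hpw R hR0.le, hRd]
      _ ≤ (C₁ * ε * t⁻¹ * r ^ (d - 2)) ^ p := by gcongr
      _ = (C₁ * ε) ^ p * r ^ d * t ^ (-p) := by
          rw [Real.mul_rpow (by positivity) (by positivity), hpw r hr.le,
            Real.mul_rpow (by positivity) (by positivity), Real.inv_rpow ht.le,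
            Real.rpow_neg ht.le]
          ring
  -- In the layer cake formula, levels below `ε` use the volume of the ball; above `ε` the decay
  -- `t^(-p)` is integrable because `p > 1`.
  have hcov : Ioi (0 : ℝ) = Ioc 0 ε ∪ Ioi ε := (Ioc_union_Ioi_eq_Ioi hε.le).symm
  calc ∫⁻ x in Metric.ball a r, ENNReal.ofReal (f x)
      = ∫⁻ t in Ioi (0 : ℝ), (volume.restrict (Metric.ball a r)) {x | t < f x} :=
        lintegral_eq_lintegral_meas_lt _ (Eventually.of_forall hf0) hf.aemeasurable
    _ = ∫⁻ t in Ioi (0 : ℝ), volume {x | x ∈ Metric.ball a r ∧ t < f x} := by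
        refine lintegral_congr fun t => ?_
        rw [Measure.restrict_apply (measurableSet_lt measurable_const hf), inter_comm]
        rfl
    _ ≤ (∫⁻ t in Ioc 0 ε, volume {x | x ∈ Metric.ball a r ∧ t < f x}) +
        ∫⁻ t in Ioi ε, volume {x | x ∈ Metric.ball a r ∧ t < f x} := by
        rw [hcov]; exact lintegral_union_le _ _ _
    _ ≤ ENNReal.ofReal (v * ε * r ^ d) + ENNReal.ofReal (C₁ ^ p / (p - 1) * ε * r ^ d) := by
        gcongr
        · calc ∫⁻ t in Ioc 0 ε, volume {x | x ∈ Metric.ball a r ∧ t < f x}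
              ≤ ∫⁻ t in Ioc 0 ε, ENNReal.ofReal (v * r ^ d) := lintegral_mono fun t => hE1 t
            _ = ENNReal.ofReal (v * ε * r ^ d) := by
                rw [setLIntegral_const, Real.volume_Ioc, sub_zero,
                  ← ENNReal.ofReal_mul (by positivity)]
                congr 1; ring
        · have hint : IntegrableOn (fun t : ℝ => (C₁ * ε) ^ p * r ^ d * t ^ (-p)) (Ioi ε) :=
            (integrableOn_Ioi_rpow_of_lt (by linarith) hε).const_mul _
          calc ∫⁻ t in Ioi ε, volume {x | x ∈ Metric.ball a r ∧ t < f x}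
              ≤ ∫⁻ t in Ioi ε, ENNReal.ofReal ((C₁ * ε) ^ p * r ^ d * t ^ (-p)) :=
                setLIntegral_mono' measurableSet_Ioi fun t ht => hE2 t (hε.trans ht)
            _ = ENNReal.ofReal (∫ t in Ioi ε, (C₁ * ε) ^ p * r ^ d * t ^ (-p)) := by
                rw [ofReal_integral_eq_lintegral_ofReal hint]
                refine ae_restrict_of_forall_mem measurableSet_Ioi fun t ht => ?_
                have : 0 < t := hε.trans ht
                positivity
            _ = ENNReal.ofReal (C₁ ^ p / (p - 1) * ε * r ^ d) := by
                congr 1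
                rw [integral_const_mul, integral_Ioi_rpow_of_lt (by linarith) hε,
                  Real.mul_rpow hC₁.le hε.le, Real.rpow_add hε, Real.rpow_neg hε.le,
                  Real.rpow_one, show -p + 1 = -(p - 1) by ring]
                have : 0 < ε ^ p := Real.rpow_pos_of_pos hε p
                field_simp
    _ = _ := by
        rw [← ENNReal.ofReal_add (by positivity) (by positivity)]
        congr 1; ring

end

/-! ### Necessity: small growth and convergence of the principal value -/

section

theorem remainderQuotient_eq_top {μ : Measure 𝔼} {a x : 𝔼} {A : Fin d → ℝ}
    (ha : rieszPotential μ a ≠ ∞) (hx : rieszPotential μ x = ∞) :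
    remainderQuotient (fun x => (rieszPotential μ x : EReal)) a A x = ∞ := by
  simp only [remainderQuotient]
  rw [hx]
  lift rieszPotential μ a to ℝ≥0 using ha with p
  have e : ∀ b : ℝ≥0, (((b : ℝ≥0∞) : EReal)) = ((b : ℝ) : EReal) := fun b => rfl
  rw [e, EReal.coe_ennreal_top, EReal.top_sub_coe, EReal.top_sub_coe, EReal.abs_top,
    ENNReal.top_div_of_ne_top enorm_ne_top]

theorem lt_remainderQuotient {μ : Measure 𝔼} {a x : 𝔼} {A : Fin d → ℝ}
    (ha : rieszPotential μ a ≠ ∞) {t : ℝ} (ht : 0 < t) (h : t < |remainder μ a A x| / ‖x - a‖) :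
    ENNReal.ofReal t < remainderQuotient (fun x => (rieszPotential μ x : EReal)) a A x := by
  have hpos : 0 < ‖x - a‖ := by
    rcases (norm_nonneg (x - a)).eq_or_lt with h0 | h0
    · rw [← h0, div_zero] at h
      linarith
    · exact h0
  by_cases hx : rieszPotential μ x = ∞
  · rw [remainderQuotient_eq_top ha hx]
    exact ENNReal.ofReal_lt_top
  · rw [remainderQuotient_eq ha hx, ← ofReal_norm, ← ENNReal.ofReal_div_of_pos hpos]
    exact (ENNReal.ofReal_lt_ofReal_iff (ht.trans h)).2 h

/-- The factor `-(d - 2)` is the one in the gradient of `‖x‖^(2-d)`, which is `-(d - 2)‖x‖^(-d) x`.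
-/
theorem tendsto_gradientDefect_iff {μ : Measure 𝔼} {a : 𝔼} {A : Fin d → ℝ} (hd : 3 ≤ d) (L : 𝔼)
    (hL : (WithLp.toLp 2 A : 𝔼) = -(((d - 2 : ℕ) : ℝ) • L)) :
    Tendsto (gradientDefect μ a A) (𝓝[>] 0) (𝓝 0) ↔
      Tendsto (truncatedRiesz μ a) (𝓝[>] 0) (𝓝 L) := by
  have hn : ((d - 2 : ℕ) : ℝ) ≠ 0 := by
    have : d - 2 ≠ 0 := by omega
    exact_mod_cast this
  have e : gradientDefect μ a A = fun s => -(((d - 2 : ℕ) : ℝ) • (truncatedRiesz μ a s - L)) := by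
    funext s
    rw [gradientDefect, hL, smul_sub]; abel
  constructor
  · intro h
    have h1 := (h.const_smul (-((d - 2 : ℕ) : ℝ)⁻¹)).add_const L
    rw [e] at h1
    simp only [smul_zero, zero_add] at h1
    refine h1.congr fun s => ?_
    rw [neg_smul_neg, smul_smul, inv_mul_cancel₀ hn, one_smul, sub_add_cancel]
  · intro h
    rw [e]
    simpa using ((h.sub_const L).const_smul ((d - 2 : ℕ) : ℝ)).neg

variable {μ : Measure (EuclideanSpace ℝ (Fin d))} [IsFiniteMeasure μ]
  {a : EuclideanSpace ℝ (Fin d)} {A : Fin d → ℝ}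

/-- Differentiability in the capacity sense implies differentiability in the mean. -/
theorem eventually_lintegral_remainder_le (hd : 3 ≤ d) (ha : rieszPotential μ a ≠ ∞)
    (hA : Tendsto (fun r : ℝ =>
        (⨆ (t : ℝ≥0) (_ : 0 < t), (t : ℝ≥0∞) * newtonianCap {x | x ∈ Metric.ball a r ∧
          (t : ℝ≥0∞) < remainderQuotient (fun x => (rieszPotential μ x : EReal)) a A x}) /
        newtonianCap (Metric.ball a r)) (𝓝[>] 0) (𝓝 0)) {ε : ℝ} (hε : 0 < ε) :
    ∀ᶠ r in 𝓝[>] (0 : ℝ), ∫⁻ x in Metric.ball a r, ENNReal.ofReal |remainder μ a A x| ≤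
      ENNReal.ofReal (ε * r ^ (d + 1)) := by
  obtain ⟨C, hC, hL⟩ := exists_lintegral_le_of_newtonianCap_le hd
  obtain ⟨c, hc, hcap⟩ := exists_le_newtonianCap_ball hd
  set η := ε / C with hη
  have hη0 : 0 < η := by positivity
  filter_upwards [ENNReal.tendsto_nhds_zero.1 hA (ENNReal.ofReal η) (by simpa using hη0),
    self_mem_nhdsWithin] with r hr (hr0 : 0 < r)
  rw [ENNReal.div_le_iff] at hr
  rotate_left
  · exact (lt_of_lt_of_le (by simp; positivity) (hcap a r hr0)).ne'
  · exact ne_top_of_le_ne_top ENNReal.ofReal_ne_top (newtonianCap_ball_le a hr0)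
  have hm := measurable_remainder μ a A
  have h1 := hL (fun x => |remainder μ a A x| / ‖x - a‖)
    (hm.abs.div (by fun_prop)) (fun x => by positivity) a r η hr0 hη0 ?_
  · calc ∫⁻ x in Metric.ball a r, ENNReal.ofReal |remainder μ a A x|
        ≤ ∫⁻ x in Metric.ball a r,
            ENNReal.ofReal r * ENNReal.ofReal (|remainder μ a A x| / ‖x - a‖) := by
          refine setLIntegral_mono' measurableSet_ball fun x hx => ?_
          rw [Metric.mem_ball, dist_eq_norm] at hx
          rw [← ENNReal.ofReal_mul hr0.le]
          refine ENNReal.ofReal_le_ofReal ?_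
          by_cases hxa : x = a
          · subst hxa
            simp [remainder]
          have hpos : 0 < ‖x - a‖ := norm_pos_iff.2 (sub_ne_zero.2 hxa)
          calc |remainder μ a A x| = ‖x - a‖ * (|remainder μ a A x| / ‖x - a‖) := by field_simp
            _ ≤ r * (|remainder μ a A x| / ‖x - a‖) := by gcongr
      _ = ENNReal.ofReal r *
          ∫⁻ x in Metric.ball a r, ENNReal.ofReal (|remainder μ a A x| / ‖x - a‖) :=
          lintegral_const_mul' _ _ ENNReal.ofReal_ne_top
      _ ≤ ENNReal.ofReal r * ENNReal.ofReal (C * η * r ^ d) := by gcongr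
      _ = _ := by
          rw [← ENNReal.ofReal_mul hr0.le, hη]
          congr 1
          rw [pow_succ]
          field_simp
  · intro t ht
    calc ENNReal.ofReal t * newtonianCap {x | x ∈ Metric.ball a r ∧
          t < |remainder μ a A x| / ‖x - a‖}
        ≤ (t.toNNReal : ℝ≥0∞) * newtonianCap {x | x ∈ Metric.ball a r ∧ (t.toNNReal : ℝ≥0∞) <
          remainderQuotient (fun x => (rieszPotential μ x : EReal)) a A x} := by
          refine mul_le_mul' le_rfl (newtonianCap_mono fun x hx => ⟨hx.1, ?_⟩)
          exact lt_remainderQuotient ha ht hx.2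
      _ ≤ ⨆ (t : ℝ≥0) (_ : 0 < t), (t : ℝ≥0∞) * newtonianCap {x | x ∈ Metric.ball a r ∧
          (t : ℝ≥0∞) < remainderQuotient (fun x => (rieszPotential μ x : EReal)) a A x} :=
          le_iSup₂_of_le t.toNNReal (by simpa using ht) le_rfl
      _ ≤ ENNReal.ofReal η * newtonianCap (Metric.ball a r) := hr
      _ ≤ ENNReal.ofReal η * ENNReal.ofReal (r ^ (d - 2)) := by
          gcongr; exact newtonianCap_ball_le a hr0
      _ = _ := (ENNReal.ofReal_mul hη0.le).symm

theorem smallGrowth_of_lintegral_remainder_le (hd : 3 ≤ d)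
    (h : ∀ ε : ℝ, 0 < ε → ∀ᶠ r in 𝓝[>] (0 : ℝ),
      ∫⁻ x in Metric.ball a r, ENNReal.ofReal |remainder μ a A x| ≤
        ENNReal.ofReal (ε * r ^ (d + 1))) : SmallGrowth μ a := by
  obtain ⟨C, hC, hb⟩ := exists_measure_ball_le hd
  refine smallGrowth_of_eventually fun ε hε => ?_
  filter_upwards [eventually_nhdsGT_mul (h (ε / (C * 3 ^ (d + 1))) (by positivity))
    (show (0 : ℝ) < 3 by norm_num), self_mem_nhdsWithin] with r hr (hr0 : 0 < r)
  calc μ (Metric.ball a r) ≤ _ := hb μ inferInstance a A r hr0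
    _ ≤ ENNReal.ofReal (C * (r ^ 2)⁻¹) *
        ENNReal.ofReal (ε / (C * 3 ^ (d + 1)) * (3 * r) ^ (d + 1)) := by gcongr
    _ = _ := by
      rw [← ENNReal.ofReal_mul (by positivity), mul_pow,
        show r ^ (d + 1) = r ^ (d - 1) * r ^ 2 by rw [← pow_add]; congr 1; omega]
      congr 1
      field_simp

/-- Lets the mean bound for potentials of finite measures apply to the near part. -/
theorem nearPotential_eq_rieszPotential (μ : Measure 𝔼) (a : 𝔼) (s : ℝ) :
    nearPotential μ a s = rieszPotential (μ.restrict {y | s < ‖y - a‖}ᶜ) := rfl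

/-- At scale `r` the linear form of the defect `w` has integral comparable to `‖w‖ r^(d+1)` on a
suitable ball, while remainder, near potentials and Taylor error all integrate to `o(r^(d+1))`. -/
theorem tendsto_gradientDefect (hd : 3 ≤ d) (hg : SmallGrowth μ a)
    (h : ∀ ε : ℝ, 0 < ε → ∀ᶠ r in 𝓝[>] (0 : ℝ),
      ∫⁻ x in Metric.ball a r, ENNReal.ofReal |remainder μ a A x| ≤
        ENNReal.ofReal (ε * r ^ (d + 1))) :
    Tendsto (gradientDefect μ a A) (𝓝[>] 0) (𝓝 0) := by
  have ha := hg.rieszPotential_ne_top hd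
  obtain ⟨C₁, hC₁, hpot⟩ := exists_lintegral_ball_rieszPotential_le hd
  set v := volume.real (Metric.ball (0 : 𝔼) 1) with hv
  have hvp : 0 < v := volume_unit_ball_pos
  set C := taylorConst d with hC
  have hC0 : 0 ≤ C := taylorConst_nonneg d
  set D : ℝ := (1 + C₁ * 4 ^ (d - 1) + (2 + C / 2) * v) / (v * (1 / 8) ^ d / 2) with hD
  have hD0 : 0 < D := by positivity
  suffices hs : ∀ ε : ℝ, 0 < ε → ∀ᶠ r in 𝓝[>] (0 : ℝ), ‖gradientDefect μ a A (2 * r)‖ ≤ D * ε by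
    refine Metric.tendsto_nhds.2 fun ε hε => ?_
    have := eventually_nhdsGT_mul (hs (ε / (2 * D)) (by positivity)) (half_pos one_pos)
    filter_upwards [this] with r hr
    rw [show 2 * (1 / 2 * r) = r by ring] at hr
    rw [dist_zero_right]
    refine hr.trans_lt ?_
    have : D * (ε / (2 * D)) = ε / 2 := by field_simp
    linarith
  intro ε hε
  obtain ⟨δ, hδ, hgδ⟩ := hg.exists_forall_le hε
  filter_upwards [h ε hε, eventually_nhdsGT_mul (hg.eventually_nearPotential_le hd hε) two_pos,
    eventually_nhdsGT_mul (hg.eventually_tailIntegral_le hd hε) two_pos,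
    Ioo_mem_nhdsGT (show 0 < δ / 4 by positivity)] with r h1 h2 h3 ⟨hr0, hrδ⟩
  set w := gradientDefect μ a A (2 * r) with hw
  rcases eq_or_ne w 0 with hw0 | hw0
  · rw [hw0, norm_zero]; positivity
  have hwp : 0 < ‖w‖ := norm_pos_iff.2 hw0
  -- Moving from `a` in the direction of `w`: `B(z, r/8)` lies in `B(a,r)`, and on it `⟨w, x - a⟩ ≥
  -- ‖w‖(3r/4 - r/8) ≥ ‖w‖ r/2`.
  set z : 𝔼 := a + (3 * r / 4 / ‖w‖) • w with hz
  have hnz : ‖z - a‖ = 3 * r / 4 := by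
    rw [hz, add_sub_cancel_left, norm_smul, Real.norm_of_nonneg (by positivity)]
    field_simp
  have hBsub : Metric.ball z (r / 8) ⊆ Metric.ball a r := by
    refine Metric.ball_subset_ball' ?_
    rw [dist_eq_norm, hnz]
    linarith
  have hinner : ∀ x ∈ Metric.ball z (r / 8), ‖w‖ * (r / 2) ≤ inner ℝ w (x - a) := by
    intro x hx
    rw [Metric.mem_ball, dist_eq_norm] at hx
    have e : x - a = (x - z) + (3 * r / 4 / ‖w‖) • w := by rw [hz]; abel
    have e1 : inner ℝ w ((3 * r / 4 / ‖w‖) • w) = ‖w‖ * (3 * r / 4) := by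
      rw [inner_smul_right, real_inner_self_eq_norm_sq]
      field_simp
    have e2 := (abs_le.1 (abs_real_inner_le_norm w (x - z))).1
    rw [e, inner_add_right, e1]
    have : ‖w‖ * ‖x - z‖ ≤ ‖w‖ * (r / 8) := by gcongr
    have : 0 < ‖w‖ * r := by positivity
    linarith
  have hnear : ∫⁻ x in Metric.ball a r, nearPotential μ a (2 * r) x ≤
      ENNReal.ofReal (C₁ * 4 ^ (d - 1) * ε * r ^ (d + 1)) := by
    rw [nearPotential_eq_rieszPotential]
    refine (hpot _ inferInstance a r hr0).trans ?_
    rw [Measure.restrict_apply_univ]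
    calc ENNReal.ofReal (C₁ * r ^ 2) * μ {y | 2 * r < ‖y - a‖}ᶜ
        ≤ ENNReal.ofReal (C₁ * r ^ 2) * ENNReal.ofReal (ε * (4 * r) ^ (d - 1)) := by
          gcongr
          refine (measure_mono fun y hy => ?_).trans (hgδ (4 * r) (by positivity) (by linarith))
          simp only [mem_compl_iff, mem_ofPred_eq, not_lt] at hy
          rw [Metric.mem_ball, dist_eq_norm]
          linarith
      _ = _ := by
          rw [← ENNReal.ofReal_mul (by positivity), mul_pow,
            show r ^ (d + 1) = r ^ (d - 1) * r ^ 2 by rw [← pow_add]; congr 1; omega]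
          congr 1; ring
  have hfin : ∀ᵐ x ∂(volume.restrict (Metric.ball a r)), rieszPotential μ x ≠ ∞ := by
    have : ∫⁻ x in Metric.ball a r, rieszPotential μ x ≠ ∞ :=
      ((hpot μ inferInstance a r hr0).trans_lt
        (ENNReal.mul_lt_top ENNReal.ofReal_lt_top (measure_lt_top _ _))).ne
    filter_upwards [ae_lt_top (measurable_rieszPotential μ) this] with x hx using hx.ne
  set e₀ : ℝ := (2 + C / 2) * ε * r with he₀
  have hpt : ∀ᵐ x ∂(volume.restrict (Metric.ball a r)), x ∈ Metric.ball a r →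
      ENNReal.ofReal |inner ℝ w (x - a)| ≤
      (ENNReal.ofReal |remainder μ a A x| + nearPotential μ a (2 * r) x) + ENNReal.ofReal e₀ := by
    filter_upwards [hfin] with x hux hx
    rw [Metric.mem_ball, dist_eq_norm] at hx
    refine (abs_inner_gradientDefect_le (A := A) hd (s := 2 * r) (by positivity) (by linarith)
      ha hux).trans ?_
    gcongr
    have q1 : (nearPotential μ a (2 * r) a).toReal ≤ ε * (2 * r) :=
      ENNReal.toReal_le_of_le_ofReal (by positivity) h2
    have q2 : C * ‖x - a‖ ^ 2 * tailIntegral μ a (2 * r) ≤ C * r ^ 2 * (ε / (2 * r)) := by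
      have : 0 ≤ tailIntegral μ a (2 * r) := integral_nonneg fun y => by positivity
      gcongr
    have q3 : C * r ^ 2 * (ε / (2 * r)) = C / 2 * ε * r := by field_simp
    rw [he₀]
    linarith
  have hmr : Measurable fun x => ENNReal.ofReal |remainder μ a A x| :=
    ENNReal.measurable_ofReal.comp (measurable_remainder μ a A).abs
  have key : ENNReal.ofReal (‖w‖ * (r / 2)) * volume (Metric.ball z (r / 8)) ≤
      ENNReal.ofReal (ε * r ^ (d + 1)) +
      ENNReal.ofReal (C₁ * 4 ^ (d - 1) * ε * r ^ (d + 1)) +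
      ENNReal.ofReal e₀ * volume (Metric.ball a r) := by
    calc ENNReal.ofReal (‖w‖ * (r / 2)) * volume (Metric.ball z (r / 8))
        = ∫⁻ x in Metric.ball z (r / 8), ENNReal.ofReal (‖w‖ * (r / 2)) :=
          (setLIntegral_const _ _).symm
      _ ≤ ∫⁻ x in Metric.ball z (r / 8), ENNReal.ofReal |inner ℝ w (x - a)| :=
          setLIntegral_mono' measurableSet_ball fun x hx =>
            ENNReal.ofReal_le_ofReal ((hinner x hx).trans (le_abs_self _))
      _ ≤ ∫⁻ x in Metric.ball a r, ENNReal.ofReal |inner ℝ w (x - a)| :=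
          lintegral_mono_set hBsub
      _ ≤ ∫⁻ x in Metric.ball a r, ((ENNReal.ofReal |remainder μ a A x| +
            nearPotential μ a (2 * r) x) + ENNReal.ofReal e₀) := by
          refine lintegral_mono_ae ?_
          filter_upwards [hpt, ae_restrict_mem measurableSet_ball] with x hx hx' using hx hx'
      _ = (∫⁻ x in Metric.ball a r, ENNReal.ofReal |remainder μ a A x|) +
          (∫⁻ x in Metric.ball a r, nearPotential μ a (2 * r) x) +
          ENNReal.ofReal e₀ * volume (Metric.ball a r) := by
          rw [lintegral_add_right _ measurable_const, lintegral_add_left hmr, setLIntegral_const]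
      _ ≤ _ := by gcongr
  rw [volume_ball_eq hd z (by positivity), volume_ball_eq hd a hr0.le,
    ← ENNReal.ofReal_mul (by positivity), ← ENNReal.ofReal_mul (by positivity),
    ← ENNReal.ofReal_add (by positivity) (by positivity),
    ← ENNReal.ofReal_add (by positivity) (by positivity),
    ENNReal.ofReal_le_ofReal_iff (by positivity), ← hv, he₀] at key
  have hrp : 0 < r ^ (d + 1) := by positivity
  have l1 : ‖w‖ * (r / 2) * (v * (r / 8) ^ d) = ‖w‖ * (v * (1 / 8) ^ d / 2) * r ^ (d + 1) := by
    rw [show r / 8 = 1 / 8 * r by ring, mul_pow, pow_succ]; ring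
  have l2 : ε * r ^ (d + 1) + C₁ * 4 ^ (d - 1) * ε * r ^ (d + 1) +
      (2 + C / 2) * ε * r * (v * r ^ d) =
      (1 + C₁ * 4 ^ (d - 1) + (2 + C / 2) * v) * ε * r ^ (d + 1) := by
    rw [pow_succ]; ring
  rw [l1, l2] at key
  have key2 := le_of_mul_le_mul_right key hrp
  rw [hD, div_mul_eq_mul_div, le_div_iff₀ (by positivity)]
  exact key2

theorem differentiableAtCap_rieszPotential_iff (hd : 3 ≤ d) :
    DifferentiableAtCap (fun x => (rieszPotential μ x : EReal)) a ↔
      SmallGrowth μ a ∧ ∃ L : 𝔼, Tendsto (truncatedRiesz μ a) (𝓝[>] 0) (𝓝 L) := by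
  have hn : ((d - 2 : ℕ) : ℝ) ≠ 0 := by
    have : d - 2 ≠ 0 := by omega
    exact_mod_cast this
  constructor
  · rintro ⟨ha, -, A, hA⟩
    have ha' : rieszPotential μ a ≠ ∞ := by simpa using ha
    have h := fun ε (hε : 0 < ε) => eventually_lintegral_remainder_le (ε := ε) hd ha' hA hε
    have hg := smallGrowth_of_lintegral_remainder_le hd h
    refine ⟨hg, -(((d - 2 : ℕ) : ℝ)⁻¹ • WithLp.toLp 2 A), ?_⟩
    refine (tendsto_gradientDefect_iff (A := A) hd _ ?_).1 (tendsto_gradientDefect hd hg h)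
    rw [smul_neg, neg_neg, smul_smul, mul_inv_cancel₀ hn, one_smul]
  · rintro ⟨hg, L, hL⟩
    exact differentiableAtCap_of_smallGrowth
      (A := WithLp.ofLp (-(((d - 2 : ℕ) : ℝ) • L))) hd hg
      ((tendsto_gradientDefect_iff hd L rfl).2 hL)

end

end CapDiff

end

theorem theorem1 (d : ℕ) (hd : 3 ≤ d)
    (μ : Measure (EuclideanSpace ℝ (Fin d))) [IsFiniteMeasure μ]
    (a : EuclideanSpace ℝ (Fin d)) :
    CapDiff.DifferentiableAtCap (fun x => (CapDiff.rieszPotential μ x : EReal)) a ↔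
      Tendsto (fun r : ℝ => μ.real (Metric.ball a r) / r ^ (d - 1)) (𝓝[>] 0) (𝓝 0) ∧
      ∃ L : EuclideanSpace ℝ (Fin d),
        Tendsto (fun ε : ℝ => ∫ y in {y | ε < ‖y - a‖}, (‖a - y‖ ^ d)⁻¹ • (a - y) ∂μ)
          (𝓝[>] 0) (𝓝 L) :=
  CapDiff.differentiableAtCap_rieszPotential_iff hd
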